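/- Let $d\ge 4$ and let $E\subset\mathbb{R}^d$ be a bounded Lebesgue measurable set of positive Lebesgue measure. Write $\lambda^d$ for Lebesgue measure on $\mathbb{R}^d$. Then a set of the form $rE+x=\{ry+x : y\in E\}$, where $r\ge 1$ and $x\in\mathbb{R}^d$, can be reconstructed using $d+1$ test sets: all these sets are Lebesgue measurable of finite measure, and there are measurable sets $T_1,\dots,T_{d+1}\subset\mathbb{R}^d$ such that whenever $A$ and $B$ are two sets of this form with $\lambda^d(A\cap T_i)=\lambda^d(B\cap T_i)$ for every $i\in\{1,\dots,d+1\}$, then $A=B$. Moreover, the parameters themselves are determined: there are measurable sets $T_1,\dots,T_{d+1}\subset\mathbb{R}^d$ such that if $x,x'\in\mathbb{R}^d$, $r,r'\ge 1$ and $(x,r)\ne(x',r')$, then $\lambda^d((rE+x)\cap T_i)\ne\lambda^d((r'E+x')\cap T_i)$ for some $i\in\{1,\dots,d+1\}$. -/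

import Mathlib

open MeasureTheory

/-- An element of the family `A` of Lebesgue measurable subsets of `ℝ^d` of finite measure can be
reconstructed using `n` test sets: there are measurable sets `T 0, …, T (n - 1)` such that two
members of the family whose intersections with every test set have equal measure coincide.
(`NullMeasurableSet _ volume` is Lebesgue measurability. The test sets are Borel; since a Lebesgue
measurable set agrees with a Borel set up to a null set, this is no restriction.) -/
def CanBeReconstructed {d : ℕ} (A : Set (Set (EuclideanSpace ℝ (Fin d)))) (n : ℕ) : Prop :=
  (∀ S ∈ A, NullMeasurableSet S volume ∧ volume S < ⊤) ∧
  ∃ T : Fin n → Set (EuclideanSpace ℝ (Fin d)), (∀ i, MeasurableSet (T i)) ∧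
    ∀ S ∈ A, ∀ S' ∈ A, (∀ i, volume (S ∩ T i) = volume (S' ∩ T i)) → S = S'

/-- The magnified copy `r E + x` of `E`. -/
def magnifiedCopy {d : ℕ} (E : Set (EuclideanSpace ℝ (Fin d))) (r : ℝ)
    (x : EuclideanSpace ℝ (Fin d)) : Set (EuclideanSpace ℝ (Fin d)) :=
  (fun y => r • y + x) '' E

/-! ### Gaussian regularization and a Bessel inequality for the Fourier transform. -/

section GaussianRegularization

open Filter Complex Module Real
open scoped Topology FourierTransform RealInnerProductSpace

variable {V : Type*} [NormedAddCommGroup V] [InnerProductSpace ℝ V]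
  [MeasurableSpace V] [BorelSpace V] [FiniteDimensional ℝ V]

/-! One test set, the whole space, yields `r ^ d` times the volume of `E`, hence `r`. The other `d`
are slabs `{y | ⟪v, y⟫ ∈ S}` for `d` spanning directions `v`. A slab sees only the marginal `μ` of
`E` along `v`: up to the factor `r ^ d` it returns the `μ`-mass of `{s | r * s + t ∈ S}` with `t =
⟪v, x⟫`. If this mass is strictly increasing in `t` for every `r ≥ 1`, the slabs determine all `⟪v,
x⟫`, hence `x`.

Such an `S` comes from `exists_measurableSet_strictMono_measure`. With the increasing density `1 / 2
+ arctan / π` in place of `S`, the mass grows with an explicit slope. The set imitates this density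
on fine cells, and the error `f` on each unit interval must have an average that is Lipschitz in `t`
with a constant small compared with that slope. The constant is at most a multiple of `∫ |ξ| |𝓕 f ξ|
|charFun μ (2πrξ)|`. Fine cells make `𝓕 f` small at low frequencies, Bessel's inequality handles the
high ones, and `charFun μ` is controlled by the energy `∫ |ξ|³ |charFun μ ξ|²`. Scaling gives a
factor `r⁻²`, which matches the decay of the arctangent slope at distance of order `r`; hence one
set serves all `r ≥ 1`.

The energy is finite for enough directions (`span_sobolevEnergy_marginal_ne_top`): `charFun μ` is
the characteristic function of `E` restricted to a line, the latter is square integrable, and polar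
coordinates put the weight `|ξ| ^ (d - 1)` on almost every line, where `d - 1 ≥ 3`. -/

/-- The Gaussian kernel whose mass concentrates at `0` as `c → ∞`. -/
noncomputable def gaussianKernel (c : ℝ) (v : V) : ℂ :=
  (π * c : ℂ) ^ (finrank ℝ V / 2 : ℂ) * cexp (-π ^ 2 * c * ‖v‖ ^ 2)

/-- The Fourier transform is moved across the pairing onto a modulated Gaussian, whose transform is
explicit. This stands in for Fourier inversion, as `𝓕 f` need not be integrable for the
discontinuous `f` used below. -/
theorem integral_gaussian_mul_fourier {f : V → ℂ} (hf : Integrable f) {c : ℝ} (hc : 0 < c)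
    (v : V) :
    ∫ w, cexp (-c⁻¹ * ‖w‖ ^ 2 + 2 * π * I * ⟪v, w⟫) * 𝓕 f w =
      ∫ w, gaussianKernel c (v - w) * f w := by
  have J : Integrable (fun w : V ↦ cexp (-c⁻¹ * ‖w‖ ^ 2 + 2 * π * I * ⟪v, w⟫)) :=
    GaussianFourier.integrable_cexp_neg_mul_sq_norm_add (by simpa) _ _
  have key : ∫ w, 𝓕 (fun w : V ↦ cexp (-c⁻¹ * ‖w‖ ^ 2 + 2 * π * I * ⟪v, w⟫)) w * f w =
      ∫ w, cexp (-c⁻¹ * ‖w‖ ^ 2 + 2 * π * I * ⟪v, w⟫) * 𝓕 f w := by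
    simpa using! (VectorFourier.integral_fourierIntegral_smul_eq_flip (L := innerₗ V)
      Real.continuous_fourierChar continuous_inner J hf)
  rw [← key]
  congr with w
  rw [fourier_gaussian_innerProductSpace' (by simpa), gaussianKernel]
  congr
  · simp
  · simp; ring

theorem norm_gaussianKernel {V : Type*} [NormedAddCommGroup V] [InnerProductSpace ℝ V]
    {c : ℝ} (hc : 0 < c) (v : V) :
    ‖gaussianKernel c v‖ = (π * c) ^ (finrank ℝ V / 2 : ℝ) * rexp (-(π ^ 2 * c) * ‖v‖ ^ 2) := by
  have h : 0 < π * c := by positivity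
  rw [gaussianKernel, norm_mul, Complex.norm_exp]
  congr 1
  · rw [← ofReal_mul, Complex.norm_cpow_eq_rpow_re_of_pos h]
    have h2 : ((finrank ℝ V : ℂ) / 2) = ((finrank ℝ V / 2 : ℝ) : ℂ) := by push_cast; rfl
    rw [h2, ofReal_re]
  · congr 1
    norm_cast
    ring

theorem integral_norm_gaussianKernel {c : ℝ} (hc : 0 < c) :
    ∫ v : V, ‖gaussianKernel c v‖ = 1 := by
  simp_rw [norm_gaussianKernel hc]
  rw [integral_const_mul, GaussianFourier.integral_rexp_neg_mul_sq_norm (by positivity),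
    ← Real.mul_rpow (by positivity) (by positivity)]
  have : π * c * (π / (π ^ 2 * c)) = 1 := by field_simp
  rw [this, Real.one_rpow]

theorem norm_integral_gaussianKernel_mul_le {f : V → ℂ} (hf : ∀ x, ‖f x‖ ≤ 1)
    {c : ℝ} (hc : 0 < c) (v : V) :
    ‖∫ w, gaussianKernel c (v - w) * f w‖ ≤ 1 := by
  have h1 : ∫ w : V, ‖gaussianKernel c (v - w)‖ = 1 := by
    rw [integral_sub_left_eq_self (fun w ↦ ‖gaussianKernel c w‖) volume v,
      integral_norm_gaussianKernel hc]
  -- A non-integrable function has integral `0` by default, so the value `1` forces integrability.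
  have h2 : Integrable (fun w : V ↦ ‖gaussianKernel c (v - w)‖) := by
    by_contra h
    rw [integral_undef h] at h1
    exact zero_ne_one h1
  rw [← h1]
  refine norm_integral_le_of_norm_le h2 (ae_of_all _ fun w ↦ ?_)
  rw [norm_mul]
  exact mul_le_of_le_one_right (norm_nonneg _) (hf w)

theorem tendsto_integral_gaussianKernel_mul {f : V → ℂ} (hf : Integrable f) {v : V}
    (h : ContinuousAt f v) :
    Tendsto (fun c : ℝ ↦ ∫ w, gaussianKernel c (v - w) * f w) atTop (𝓝 (f v)) :=
  Real.tendsto_integral_gaussian_smul' hf h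

theorem continuous_fourier_of_integrable {f : V → ℂ} (hf : Integrable f) : Continuous (𝓕 f) :=
  VectorFourier.fourierIntegral_continuous Real.continuous_fourierChar
    (by exact continuous_inner) hf

theorem norm_fourier_le_integral_norm (f : V → ℂ) (w : V) : ‖𝓕 f w‖ ≤ ∫ v, ‖f v‖ :=
  VectorFourier.norm_fourierIntegral_le_integral_norm _ _ _ _ _

theorem integrable_gaussian {c : ℝ} (hc : 0 < c) :
    Integrable (fun w : V ↦ rexp (-c⁻¹ * ‖w‖ ^ 2)) := by
  have := (GaussianFourier.integrable_cexp_neg_mul_sq_norm_add (V := V) (b := (c⁻¹ : ℝ))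
    (by simpa) 0 0).norm
  refine this.congr (ae_of_all _ fun w ↦ ?_)
  simp only [Complex.norm_exp]
  congr 1
  simp [← ofReal_pow]

/-- Since `f` is real, `𝓕 f (-w)` is the conjugate of `𝓕 f w`, so the left side pairs `𝓕 f` with `u
w = exp (-|w|² / c) * 𝓕 f (-w)`. Moving the transform onto `u` gives `f` smoothed by the Gaussian
kernel, which is bounded by `1`. -/
theorem integral_gaussian_mul_norm_fourier_sq_le {f : V → ℝ} (hf : Integrable f)
    (hf1 : ∀ x, |f x| ≤ 1) {c : ℝ} (hc : 0 < c) :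
    ∫ w, rexp (-c⁻¹ * ‖w‖ ^ 2) * ‖𝓕 (fun x ↦ (f x : ℂ)) w‖ ^ 2 ≤ ∫ x, |f x| := by
  set g : V → ℂ := fun x ↦ (f x : ℂ) with hg
  have hgi : Integrable g := hf.ofReal
  have hconj : ∀ w, 𝓕 g (-w) = (starRingEnd ℂ) (𝓕 g w) := by
    intro w
    rw [Real.fourier_eq', Real.fourier_eq', ← integral_conj]
    congr with v
    simp [hg, ← Complex.exp_conj, Complex.conj_ofNat]
  set u : V → ℂ := fun w ↦ cexp (-c⁻¹ * ‖w‖ ^ 2) * 𝓕 g (-w) with hu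
  have hgauss : Integrable (fun w : V ↦ cexp (-c⁻¹ * ‖w‖ ^ 2)) := by
    simpa using GaussianFourier.integrable_cexp_neg_mul_sq_norm_add (V := V) (b := (c⁻¹ : ℝ))
      (by simpa) 0 0
  have hui : Integrable u := by
    refine hgauss.mul_bdd (c := ∫ v, ‖g v‖) ?_ (ae_of_all _ fun w ↦
      norm_fourier_le_integral_norm g (-w))
    exact ((continuous_fourier_of_integrable hgi).comp continuous_neg).aestronglyMeasurable
  have hFu : ∀ x, 𝓕 u x = ∫ w, gaussianKernel c (x - w) * g w := by
    intro x
    rw [← integral_gaussian_mul_fourier hgi hc, Real.fourier_eq',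
      ← integral_neg_eq_self]
    congr with w
    simp only [hu, smul_eq_mul, norm_neg, neg_neg, inner_neg_left, ← mul_assoc,
      ← Complex.exp_add]
    rw [real_inner_comm]
    congr 2
    push_cast
    ring
  have key : ∫ w, 𝓕 u w * g w = ∫ w, u w * 𝓕 g w := by
    simpa using! (VectorFourier.integral_fourierIntegral_smul_eq_flip (L := innerₗ V)
      Real.continuous_fourierChar continuous_inner hui hgi)
  have h2 : ∫ w, u w * 𝓕 g w =
      ((∫ w, rexp (-c⁻¹ * ‖w‖ ^ 2) * ‖𝓕 g w‖ ^ 2 : ℝ) : ℂ) := by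
    rw [← integral_complex_ofReal]
    congr with w
    simp only [hu, hconj, mul_assoc, Complex.conj_mul']
    push_cast
    rfl
  have h3 : ‖∫ w, 𝓕 u w * g w‖ ≤ ∫ x, |f x| := by
    refine norm_integral_le_of_norm_le hf.abs (ae_of_all _ fun x ↦ ?_)
    rw [norm_mul, hFu]
    have : ‖g x‖ = |f x| := by simp [hg]
    rw [this]
    refine mul_le_of_le_one_left (abs_nonneg _) ?_
    exact norm_integral_gaussianKernel_mul_le (fun x ↦ by simpa [hg] using hf1 x) hc x
  rw [key, h2, Complex.norm_real] at h3
  exact (le_abs_self _).trans h3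

/-- A form of Bessel's inequality for the Fourier transform of a bounded integrable function. -/
theorem lintegral_enorm_fourier_sq_le {f : V → ℝ} (hf : Integrable f)
    (hf1 : ∀ x, |f x| ≤ 1) :
    ∫⁻ w, ‖𝓕 (fun x ↦ (f x : ℂ)) w‖ₑ ^ 2 ≤ ENNReal.ofReal (∫ x, |f x|) := by
  set g : V → ℂ := fun x ↦ (f x : ℂ) with hg
  have hgi : Integrable g := hf.ofReal
  have hcont := continuous_fourier_of_integrable hgi
  set F : ℕ → V → ENNReal := fun n w ↦
    ENNReal.ofReal (rexp (-((n : ℝ) + 1)⁻¹ * ‖w‖ ^ 2) * ‖𝓕 g w‖ ^ 2) with hF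
  have hlim : ∀ w, Tendsto (fun n ↦ F n w) atTop (𝓝 (‖𝓕 g w‖ₑ ^ 2)) := by
    intro w
    have h0 : Tendsto (fun n : ℕ ↦ ((n : ℝ) + 1)⁻¹) atTop (𝓝 0) := by
      simpa using tendsto_one_div_add_atTop_nhds_zero_nat (𝕜 := ℝ)
    have h1 : Tendsto (fun n : ℕ ↦ rexp (-((n : ℝ) + 1)⁻¹ * ‖w‖ ^ 2) * ‖𝓕 g w‖ ^ 2) atTop
        (𝓝 (rexp (-0 * ‖w‖ ^ 2) * ‖𝓕 g w‖ ^ 2)) :=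
      ((Real.continuous_exp.tendsto _).comp (h0.neg.mul_const _)).mul_const _
    have h2 := ENNReal.tendsto_ofReal h1
    have h3 : ENNReal.ofReal (rexp (-0 * ‖w‖ ^ 2) * ‖𝓕 g w‖ ^ 2) = ‖𝓕 g w‖ₑ ^ 2 := by
      simp [ENNReal.ofReal_pow]
    rwa [h3] at h2
  have hbound : ∀ n, ∫⁻ w, F n w ≤ ENNReal.ofReal (∫ x, |f x|) := by
    intro n
    have hc : (0 : ℝ) < (n : ℝ) + 1 := by positivity
    rw [hF, ← ofReal_integral_eq_lintegral_ofReal]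
    · exact ENNReal.ofReal_le_ofReal (integral_gaussian_mul_norm_fourier_sq_le hf hf1 hc)
    · refine (integrable_gaussian hc).mul_bdd (c := (∫ v, ‖g v‖) ^ 2) ?_ (ae_of_all _ fun w ↦ ?_)
      · exact (hcont.norm.pow 2).aestronglyMeasurable
      · rw [norm_pow, norm_norm]
        gcongr
        exact norm_fourier_le_integral_norm g w
    · exact ae_of_all _ fun w ↦ by positivity
  -- Fatou's lemma along `c = n + 1` removes the Gaussian weight.
  calc ∫⁻ w, ‖𝓕 g w‖ₑ ^ 2 = ∫⁻ w, liminf (fun n ↦ F n w) atTop := by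
        congr with w
        exact (hlim w).liminf_eq.symm
    _ ≤ liminf (fun n ↦ ∫⁻ w, F n w) atTop := by
        refine lintegral_liminf_le fun n ↦ ?_
        have : Continuous fun w ↦ rexp (-((n : ℝ) + 1)⁻¹ * ‖w‖ ^ 2) * ‖𝓕 g w‖ ^ 2 := by
          fun_prop
        exact ENNReal.measurable_ofReal.comp this.measurable
    _ ≤ ENNReal.ofReal (∫ x, |f x|) := by
        refine liminf_le_of_le (by isBoundedDefault) fun b hb ↦ ?_
        obtain ⟨n, hn⟩ := hb.exists
        exact hn.trans (hbound n)

end GaussianRegularization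

/-! ### Lipschitz dependence on the translation, seen on the Fourier side. -/

section LipschitzEstimate

open Filter Complex Module Real
open scoped Topology FourierTransform RealInnerProductSpace

/-- Fubini: integrating the character in `s` first produces `charFun μ`. The Gaussian factor
supplies the absolute convergence. -/
theorem integral_gaussian_average_affine {μ : Measure ℝ} [IsFiniteMeasure μ] {f : ℝ → ℂ}
    (hf : Integrable f) {c : ℝ} (hc : 0 < c) (r t : ℝ) :
    ∫ s, (∫ w, gaussianKernel c (r * s + t - w) * f w) ∂μ =
      ∫ ξ : ℝ, cexp (-c⁻¹ * ‖ξ‖ ^ 2) * cexp (I * (2 * π * t * ξ : ℝ)) *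
        (𝓕 f ξ * charFun μ (2 * π * r * ξ)) := by
  simp_rw [← integral_gaussian_mul_fourier hf hc]
  have hgauss : Integrable (fun w : ℝ ↦ cexp (-c⁻¹ * ‖w‖ ^ 2)) := by
    simpa using GaussianFourier.integrable_cexp_neg_mul_sq_norm_add (V := ℝ) (b := (c⁻¹ : ℝ))
      (by simpa) 0 0
  have hcont := continuous_fourier_of_integrable hf
  have hG : Integrable (fun ξ : ℝ ↦ cexp (-c⁻¹ * ‖ξ‖ ^ 2) * 𝓕 f ξ) :=
    hgauss.mul_bdd (c := ∫ v, ‖f v‖) hcont.aestronglyMeasurable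
      (ae_of_all _ fun w ↦ norm_fourier_le_integral_norm f w)
  have hsplit : ∀ s w : ℝ, cexp (-c⁻¹ * ‖w‖ ^ 2 + 2 * π * I * ⟪r * s + t, w⟫) * 𝓕 f w =
      cexp (I * (2 * π * (r * s + t) * w : ℝ)) * (cexp (-c⁻¹ * ‖w‖ ^ 2) * 𝓕 f w) := by
    intro s w
    rw [Complex.exp_add, mul_comm (cexp (-c⁻¹ * ‖w‖ ^ 2)), mul_assoc]
    congr 2
    simp
    ring
  simp_rw [hsplit]
  rw [integral_integral_swap]
  · congr with ξ
    rw [integral_mul_const, charFun_apply_real]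
    have : ∀ s : ℝ, cexp (I * (2 * π * (r * s + t) * ξ : ℝ)) =
        cexp (I * (2 * π * t * ξ : ℝ)) * cexp ((2 * π * r * ξ : ℝ) * s * I) := by
      intro s
      rw [← Complex.exp_add]
      congr 1
      push_cast
      ring
    simp_rw [this]
    rw [integral_const_mul]
    ring
  · have h1 : Integrable (fun p : ℝ × ℝ ↦ (1 : ℂ) * (cexp (-c⁻¹ * ‖p.2‖ ^ 2) * 𝓕 f p.2))
        (μ.prod volume) := (integrable_const (1 : ℂ)).mul_prod hG
    refine h1.mono ?_ (ae_of_all _ fun p ↦ ?_)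
    · refine Continuous.aestronglyMeasurable ?_
      unfold Function.uncurry
      fun_prop
    · simp only [Function.uncurry, norm_mul, one_mul]
      rw [mul_comm I, Complex.norm_exp_ofReal_mul_I, one_mul]

theorem integrable_charFun_mul_gaussian {μ : Measure ℝ} [IsFiniteMeasure μ] {f : ℝ → ℂ}
    (hf : Integrable f) {c : ℝ} (hc : 0 < c) (r t : ℝ) :
    Integrable fun ξ : ℝ ↦ cexp (-c⁻¹ * ‖ξ‖ ^ 2) * cexp (I * (2 * π * t * ξ : ℝ)) *
        (𝓕 f ξ * charFun μ (2 * π * r * ξ)) := by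
  have hgauss : Integrable (fun w : ℝ ↦ cexp (-c⁻¹ * ‖w‖ ^ 2)) := by
    simpa using GaussianFourier.integrable_cexp_neg_mul_sq_norm_add (V := ℝ) (b := (c⁻¹ : ℝ))
      (by simpa) 0 0
  have hcont := continuous_fourier_of_integrable hf
  have hchar : Continuous fun ξ : ℝ ↦ charFun μ (2 * π * r * ξ) :=
    continuous_charFun.comp (by fun_prop)
  simp_rw [mul_assoc]
  refine hgauss.mul_bdd (c := (∫ v, ‖f v‖) * μ.real Set.univ) ?_ (ae_of_all _ fun w ↦ ?_)
  · refine Continuous.aestronglyMeasurable ?_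
    simp_rw [mul_assoc] at hchar
    fun_prop
  · rw [norm_mul, norm_mul, mul_comm I, Complex.norm_exp_ofReal_mul_I, one_mul]
    gcongr
    · exact norm_fourier_le_integral_norm f w
    · exact norm_charFun_le _

/-- The integrals of the translates of `f` against the dilates of `μ` are Lipschitz. -/
theorem enorm_integral_affine_sub_le {μ : Measure ℝ} [IsFiniteMeasure μ] (hμ : μ ≪ volume)
    {f : ℝ → ℂ} (hf : Integrable f) (hf1 : ∀ x, ‖f x‖ ≤ 1) (hfc : ∀ᵐ x, ContinuousAt f x)
    {r : ℝ} (hr : 0 < r) (t t' : ℝ) :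
    ‖(∫ s, f (r * s + t') ∂μ) - ∫ s, f (r * s + t) ∂μ‖ₑ ≤
      ENNReal.ofReal (2 * π * |t' - t|) *
        ∫⁻ ξ : ℝ, ‖ξ‖ₑ * (‖𝓕 f ξ‖ₑ * ‖charFun μ (2 * π * r * ξ)‖ₑ) := by
  have hlim : ∀ u : ℝ, Tendsto
      (fun c : ℝ ↦ ∫ s, (∫ w, gaussianKernel c (r * s + u - w) * f w) ∂μ) atTop
      (𝓝 (∫ s, f (r * s + u) ∂μ)) := by
    intro u
    refine tendsto_integral_filter_of_dominated_convergence (fun _ ↦ 1) ?_ ?_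
      (integrable_const 1) ?_
    · filter_upwards [eventually_gt_atTop 0] with c hc
      have hk : StronglyMeasurable (fun p : ℝ × ℝ ↦
          gaussianKernel c (r * p.1 + u - p.2)) := by
        refine Continuous.stronglyMeasurable ?_
        unfold gaussianKernel
        fun_prop
      have : AEStronglyMeasurable (fun p : ℝ × ℝ ↦
          gaussianKernel c (r * p.1 + u - p.2) * f p.2) (μ.prod volume) :=
        hk.aestronglyMeasurable.mul hf.1.comp_snd
      exact this.integral_prod_right'
    · filter_upwards [eventually_gt_atTop 0] with c hc
      exact ae_of_all _ fun s ↦ norm_integral_gaussianKernel_mul_le hf1 hc _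
    -- Pointwise convergence is available only where `f` is continuous at `r * s + u`. The
    -- exceptional `s` form a Lebesgue null set, hence a `μ`-null set.
    · have hq : Measure.QuasiMeasurePreserving (fun s : ℝ ↦ r * s + u) volume volume := by
        refine ⟨by fun_prop, ?_⟩
        have e : (fun s : ℝ ↦ r * s + u) = (fun y ↦ y + u) ∘ (fun s ↦ r * s) := rfl
        rw [e, ← Measure.map_map (by fun_prop) (by fun_prop),
          Real.map_volume_mul_left hr.ne', Measure.map_smul,
          (measurePreserving_add_right volume u).map_eq]
        exact Measure.smul_absolutelyContinuous
      filter_upwards [hμ.ae_le (hq.ae hfc)] with s hs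
      exact tendsto_integral_gaussianKernel_mul hf hs
  have hlim2 := ((hlim t').sub (hlim t)).enorm
  refine le_of_tendsto hlim2 ?_
  filter_upwards [eventually_gt_atTop 0] with c hc
  rw [integral_gaussian_average_affine hf hc, integral_gaussian_average_affine hf hc,
    ← integral_sub (integrable_charFun_mul_gaussian hf hc r t')
      (integrable_charFun_mul_gaussian hf hc r t)]
  refine (enorm_integral_le_lintegral_enorm _).trans ?_
  rw [← lintegral_const_mul' _ _ ENNReal.ofReal_ne_top]
  refine lintegral_mono fun ξ ↦ ?_
  rw [← sub_mul, ← mul_sub, enorm_mul, enorm_mul, enorm_mul, ← mul_assoc (ENNReal.ofReal _)]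
  refine mul_le_mul' ?_ le_rfl
  have h1 : ‖cexp (-c⁻¹ * ‖ξ‖ ^ 2)‖ₑ ≤ 1 := by
    rw [← _root_.ofReal_norm, ENNReal.ofReal_le_one, Complex.norm_exp, Real.exp_le_one_iff]
    have : (-((c⁻¹ : ℝ) : ℂ) * (‖ξ‖ : ℂ) ^ 2).re = -(c⁻¹ * ‖ξ‖ ^ 2) := by
      rw [← ofReal_re (-(c⁻¹ * ‖ξ‖ ^ 2))]
      push_cast
      ring_nf
    rw [this]
    have : 0 ≤ c⁻¹ * ‖ξ‖ ^ 2 := by positivity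
    linarith
  have h2 : ‖cexp (I * (2 * π * t' * ξ : ℝ)) - cexp (I * (2 * π * t * ξ : ℝ))‖ₑ ≤
      ENNReal.ofReal (2 * π * |t' - t|) * ‖ξ‖ₑ := by
    have e : cexp (I * (2 * π * t' * ξ : ℝ)) - cexp (I * (2 * π * t * ξ : ℝ)) =
        cexp ((2 * π * t * ξ : ℝ) * I) * (cexp (I * (2 * π * (t' - t) * ξ : ℝ)) - 1) := by
      rw [mul_sub, ← Complex.exp_add, mul_one]
      congr 2 <;> push_cast <;> ring
    rw [e, enorm_mul, ← _root_.ofReal_norm (cexp _), Complex.norm_exp_ofReal_mul_I,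
      ENNReal.ofReal_one, one_mul]
    refine enorm_exp_I_mul_ofReal_sub_one_le.trans_eq ?_
    rw [enorm_mul, ← _root_.ofReal_norm (2 * π * (t' - t)), Real.norm_eq_abs, abs_mul,
      abs_of_pos (by positivity : 0 < 2 * π)]
  calc _ ≤ 1 * (ENNReal.ofReal (2 * π * |t' - t|) * ‖ξ‖ₑ) := mul_le_mul' h1 h2
    _ = _ := one_mul _

end LipschitzEstimate

/-! ### Splitting the frequency integral into low and high frequencies. -/

section FrequencyEstimate

open Filter Complex Module Real
open scoped Topology FourierTransform RealInnerProductSpace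

theorem lintegral_comp_mul_left (g : ℝ → ENNReal) (hg : Measurable g) {a : ℝ} (ha : a ≠ 0) :
    ∫⁻ x, g (a * x) = ENNReal.ofReal |a⁻¹| * ∫⁻ x, g x := by
  rw [← lintegral_map hg (measurable_const_mul a), Real.map_volume_mul_left ha,
    lintegral_smul_measure, smul_eq_mul]

/-- The squared homogeneous Sobolev norm of order `3 / 2` of a measure on the line. -/
noncomputable def sobolevEnergy (μ : Measure ℝ) : ENNReal :=
  ∫⁻ ξ : ℝ, ‖ξ‖ₑ ^ 3 * ‖charFun μ ξ‖ₑ ^ 2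

/-- A weighted AM-GM inequality between `|x|⁻¹ p²` and `|x|³ q²`, followed by a cut at `|x| = L`:
below it `p ≤ δ |x|` is used, above it `|x|⁻¹ ≤ L⁻¹`. -/
theorem mul_mul_le_weighted {x p q δ L lam : ℝ} (hp : 0 ≤ p) (hL : 0 < L)
    (hlam : 0 < lam) (hpx : p ≤ δ * |x|) :
    |x| * (p * q) ≤ lam * ((Set.Icc (-L) L).indicator (fun _ ↦ δ ^ 2 * L) x + L⁻¹ * p ^ 2) +
      lam⁻¹ * (|x| ^ 3 * q ^ 2) := by
  rcases eq_or_ne x 0 with rfl | hx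
  · have : 0 ≤ (Set.Icc (-L) L).indicator (fun _ ↦ δ ^ 2 * L) 0 :=
      Set.indicator_nonneg (fun _ _ ↦ by positivity) _
    simp only [abs_zero, zero_mul]
    positivity
  have hx' : 0 < |x| := abs_pos.mpr hx
  have h1 : |x|⁻¹ * p ^ 2 ≤
      (Set.Icc (-L) L).indicator (fun _ ↦ δ ^ 2 * L) x + L⁻¹ * p ^ 2 := by
    by_cases hxL : x ∈ Set.Icc (-L) L
    · rw [Set.indicator_of_mem hxL]
      have : |x| ≤ L := abs_le.mpr hxL
      have h2 : p ^ 2 ≤ (δ * |x|) ^ 2 := by gcongr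
      have h3 : |x|⁻¹ * p ^ 2 ≤ |x|⁻¹ * (δ * |x|) ^ 2 := by gcongr
      have h4 : |x|⁻¹ * (δ * |x|) ^ 2 = δ ^ 2 * |x| := by field_simp
      have h5 : δ ^ 2 * |x| ≤ δ ^ 2 * L := by gcongr
      have h6 : 0 ≤ L⁻¹ * p ^ 2 := by positivity
      linarith
    · rw [Set.indicator_of_notMem hxL, zero_add]
      have : L ≤ |x| := by
        by_contra h
        exact hxL (abs_le.mp (not_le.mp h).le)
      gcongr
  have h2 : |x| * (p * q) ≤ lam * (|x|⁻¹ * p ^ 2) + lam⁻¹ * (|x| ^ 3 * q ^ 2) := by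
    have e : lam * (|x|⁻¹ * p ^ 2) + lam⁻¹ * (|x| ^ 3 * q ^ 2) - |x| * (p * q) =
        (lam * |x|)⁻¹ * ((lam * p - |x| ^ 2 * q / 2) ^ 2 + 3 / 4 * (|x| ^ 2 * q) ^ 2) := by
      field_simp
      ring
    have : 0 ≤ (lam * |x|)⁻¹ *
        ((lam * p - |x| ^ 2 * q / 2) ^ 2 + 3 / 4 * (|x| ^ 2 * q) ^ 2) := by positivity
    linarith
  have h3 := mul_le_mul_of_nonneg_left h1 hlam.le
  linarith

theorem lintegral_frequency_le {μ : Measure ℝ} [IsFiniteMeasure μ] {f : ℝ → ℝ}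
    (hf : Integrable f) (hf1 : ∀ x, |f x| ≤ 1) (hf2 : ∫ x, |f x| ≤ 1) {δ L κ r : ℝ}
    (hL : 0 < L) (hκ : 0 < κ) (hr : 0 < r)
    (hδ : ∀ ξ, ‖𝓕 (fun x ↦ (f x : ℂ)) ξ‖ ≤ δ * |ξ|) :
    ∫⁻ ξ : ℝ, ‖ξ‖ₑ * (‖𝓕 (fun x ↦ (f x : ℂ)) ξ‖ₑ * ‖charFun μ (2 * π * r * ξ)‖ₑ) ≤
      ENNReal.ofReal ((r ^ 2)⁻¹) *
        (ENNReal.ofReal (κ⁻¹ * (2 * L ^ 2 * δ ^ 2 + L⁻¹)) +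
          ENNReal.ofReal κ * sobolevEnergy μ) := by
  set F : ℝ → ℂ := 𝓕 (fun x ↦ (f x : ℂ)) with hF
  have hFc : Continuous F := continuous_fourier_of_integrable hf.ofReal
  have hchar : Continuous fun ξ : ℝ ↦ charFun μ ξ := continuous_charFun
  -- Rescaling the energy costs `r⁻⁴`, so with this weight the terms carrying `lam` and `lam⁻¹ *
  -- r⁻⁴` both decay like `r⁻²`.
  set lam : ℝ := (r ^ 2)⁻¹ * κ⁻¹ with hlam
  have hlam0 : 0 < lam := by positivity
  set q : ℝ → ℂ := fun ξ ↦ charFun μ (2 * π * r * ξ) with hq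
  have hqc : Continuous q := hchar.comp (by fun_prop)
  have hpt : ∀ ξ : ℝ, ‖ξ‖ₑ * (‖F ξ‖ₑ * ‖q ξ‖ₑ) ≤
      ENNReal.ofReal lam * ((Set.Icc (-L) L).indicator (fun _ ↦ ENNReal.ofReal (δ ^ 2 * L)) ξ +
        ENNReal.ofReal L⁻¹ * ‖F ξ‖ₑ ^ 2) +
      ENNReal.ofReal lam⁻¹ * (‖ξ‖ₑ ^ 3 * ‖q ξ‖ₑ ^ 2) := by
    intro ξ
    have h := ENNReal.ofReal_le_ofReal
      (mul_mul_le_weighted (q := ‖q ξ‖) (norm_nonneg (F ξ)) hL hlam0 (hδ ξ))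
    have h0 : 0 ≤ (Set.Icc (-L) L).indicator (fun _ ↦ δ ^ 2 * L) ξ :=
      Set.indicator_nonneg (fun _ _ ↦ by positivity) _
    have hi : (Set.Icc (-L) L).indicator (fun _ ↦ ENNReal.ofReal (δ ^ 2 * L)) ξ =
        ENNReal.ofReal ((Set.Icc (-L) L).indicator (fun _ ↦ δ ^ 2 * L) ξ) := by
      by_cases hx : ξ ∈ Set.Icc (-L) L <;> simp [hx]
    have e1 : ‖ξ‖ₑ = ENNReal.ofReal |ξ| := by rw [← _root_.ofReal_norm, Real.norm_eq_abs]
    rw [hi, e1, ← _root_.ofReal_norm (F ξ), ← _root_.ofReal_norm (q ξ),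
      ← ENNReal.ofReal_mul (norm_nonneg _), ← ENNReal.ofReal_mul (abs_nonneg _),
      ← ENNReal.ofReal_pow (norm_nonneg _), ← ENNReal.ofReal_pow (norm_nonneg _),
      ← ENNReal.ofReal_pow (abs_nonneg _),
      ← ENNReal.ofReal_mul (by positivity), ← ENNReal.ofReal_mul (by positivity),
      ← ENNReal.ofReal_add h0 (by positivity), ← ENNReal.ofReal_mul (by positivity),
      ← ENNReal.ofReal_mul (by positivity),
      ← ENNReal.ofReal_add (by positivity) (by positivity)]
    exact h
  have hscale : ∫⁻ ξ : ℝ, ‖ξ‖ₑ ^ 3 * ‖q ξ‖ₑ ^ 2 ≤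
      ENNReal.ofReal ((r ^ 4)⁻¹) * sobolevEnergy μ := by
    obtain ⟨a, ha⟩ : ∃ a, a = 2 * π * r := ⟨_, rfl⟩
    have ha0 : 0 < a := by rw [ha]; positivity
    have h1 : ∀ ξ : ℝ, ‖ξ‖ₑ ^ 3 * ‖q ξ‖ₑ ^ 2 =
        ENNReal.ofReal ((a ^ 3)⁻¹) * (‖a * ξ‖ₑ ^ 3 * ‖charFun μ (a * ξ)‖ₑ ^ 2) := by
      intro ξ
      simp only [hq, ← ha]
      rw [enorm_mul, mul_pow, ← mul_assoc, ← mul_assoc]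
      have : ENNReal.ofReal (a ^ 3)⁻¹ * ‖a‖ₑ ^ 3 = 1 := by
        rw [← _root_.ofReal_norm, Real.norm_of_nonneg ha0.le, ← ENNReal.ofReal_pow ha0.le,
          ← ENNReal.ofReal_mul (by positivity), inv_mul_cancel₀ (by positivity),
          ENNReal.ofReal_one]
      rw [this, one_mul]
    simp_rw [h1]
    rw [lintegral_const_mul' _ _ ENNReal.ofReal_ne_top,
      lintegral_comp_mul_left (fun y ↦ ‖y‖ₑ ^ 3 * ‖charFun μ y‖ₑ ^ 2) (by fun_prop) ha0.ne',
      ← mul_assoc, ← ENNReal.ofReal_mul (by positivity), sobolevEnergy]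
    gcongr
    rw [abs_of_pos (by positivity), ← mul_inv, ← pow_succ]
    gcongr
    rw [ha]
    have : 1 ≤ 2 * π := by nlinarith [Real.pi_gt_three]
    nlinarith
  calc ∫⁻ ξ : ℝ, ‖ξ‖ₑ * (‖F ξ‖ₑ * ‖q ξ‖ₑ)
      ≤ ∫⁻ ξ : ℝ, (ENNReal.ofReal lam *
          ((Set.Icc (-L) L).indicator (fun _ ↦ ENNReal.ofReal (δ ^ 2 * L)) ξ +
            ENNReal.ofReal L⁻¹ * ‖F ξ‖ₑ ^ 2) +
          ENNReal.ofReal lam⁻¹ * (‖ξ‖ₑ ^ 3 * ‖q ξ‖ₑ ^ 2)) := lintegral_mono hpt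
    _ = ENNReal.ofReal lam * (ENNReal.ofReal (δ ^ 2 * L) * ENNReal.ofReal (L - -L) +
          ENNReal.ofReal L⁻¹ * ∫⁻ ξ, ‖F ξ‖ₑ ^ 2) +
          ENNReal.ofReal lam⁻¹ * ∫⁻ ξ : ℝ, ‖ξ‖ₑ ^ 3 * ‖q ξ‖ₑ ^ 2 := by
        rw [lintegral_add_right _ (by fun_prop), lintegral_const_mul' _ _ ENNReal.ofReal_ne_top,
          lintegral_const_mul' _ _ ENNReal.ofReal_ne_top, lintegral_add_right _ (by fun_prop),
          lintegral_const_mul' _ _ ENNReal.ofReal_ne_top,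
          lintegral_indicator_const measurableSet_Icc, Real.volume_Icc]
    _ ≤ ENNReal.ofReal lam * (ENNReal.ofReal (δ ^ 2 * L) * ENNReal.ofReal (L - -L) +
          ENNReal.ofReal L⁻¹ * 1) +
          ENNReal.ofReal lam⁻¹ * (ENNReal.ofReal ((r ^ 4)⁻¹) * sobolevEnergy μ) := by
        gcongr
        refine (lintegral_enorm_fourier_sq_le hf hf1).trans ?_
        rwa [ENNReal.ofReal_le_one]
    _ = _ := by
        rw [mul_one, ← ENNReal.ofReal_mul (by positivity),
          ← ENNReal.ofReal_add (mul_nonneg (by positivity) (by linarith)) (by positivity),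
          ← ENNReal.ofReal_mul hlam0.le, ← mul_assoc, ← ENNReal.ofReal_mul (by positivity),
          mul_add (ENNReal.ofReal (r ^ 2)⁻¹), ← mul_assoc (ENNReal.ofReal (r ^ 2)⁻¹),
          ← ENNReal.ofReal_mul (by positivity), ← ENNReal.ofReal_mul (by positivity)]
        congr 1
        · congr 1
          rw [hlam]
          ring
        · congr 2
          rw [hlam]
          field_simp

/-- The energy term, the high frequencies and the low frequencies each receive `η / 3`, through the
choice of `κ`, then `L`, then `δ`. The resulting `δ` is uniform in `f` and `r`. -/
theorem exists_forall_lintegral_frequency_le {μ : Measure ℝ} [IsFiniteMeasure μ]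
    (hμ : sobolevEnergy μ ≠ ⊤) {η : ℝ} (hη : 0 < η) :
    ∃ δ : ℝ, 0 < δ ∧ ∀ f : ℝ → ℝ, Integrable f → (∀ x, |f x| ≤ 1) → ∫ x, |f x| ≤ 1 →
      (∀ ξ, ‖𝓕 (fun x ↦ (f x : ℂ)) ξ‖ ≤ δ * |ξ|) → ∀ r : ℝ, 0 < r →
      ∫⁻ ξ : ℝ, ‖ξ‖ₑ * (‖𝓕 (fun x ↦ (f x : ℂ)) ξ‖ₑ * ‖charFun μ (2 * π * r * ξ)‖ₑ) ≤
        ENNReal.ofReal (η * (r ^ 2)⁻¹) := by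
  set D := (sobolevEnergy μ).toReal with hD
  have hD0 : 0 ≤ D := ENNReal.toReal_nonneg
  have hDe : sobolevEnergy μ = ENNReal.ofReal D := (ENNReal.ofReal_toReal hμ).symm
  set κ : ℝ := η / (3 * (D + 1)) with hκ
  have hκ0 : 0 < κ := by positivity
  set L : ℝ := 3 / (κ * η) with hL
  have hL0 : 0 < L := by positivity
  refine ⟨√(κ * η / (6 * L ^ 2)), by positivity, fun f hf hf1 hf2 hδ r hr ↦ ?_⟩
  refine (lintegral_frequency_le hf hf1 hf2 hL0 hκ0 hr hδ).trans ?_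
  rw [hDe, ← ENNReal.ofReal_mul hκ0.le, ← ENNReal.ofReal_add (by positivity) (by positivity),
    ← ENNReal.ofReal_mul (by positivity), Real.sq_sqrt (by positivity)]
  apply ENNReal.ofReal_le_ofReal
  rw [mul_comm]
  gcongr
  have h1 : κ⁻¹ * (2 * L ^ 2 * (κ * η / (6 * L ^ 2)) + L⁻¹) = 2 * η / 3 := by
    rw [hL]
    field_simp
    ring
  have h2 : κ * D ≤ η / 3 := by
    rw [hκ, div_mul_eq_mul_div, div_le_iff₀ (by positivity)]
    nlinarith
  rw [h1]
  linarith

end FrequencyEstimate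

/-! ### Replacing a density by a set on fine cells. -/

section Discretization

open Filter Complex Module Real
open scoped Topology FourierTransform RealInnerProductSpace

/-- The difference between the indicator of `S` and the density `h` on the interval `[a, b)`. -/
noncomputable def densityDefect (h : ℝ → ℝ) (S : Set ℝ) (a b : ℝ) (x : ℝ) : ℝ :=
  S.indicator (fun _ ↦ 1) x - (Set.Ico a b).indicator h x

variable {h : ℝ → ℝ}

theorem abs_densityDefect_le (h0 : ∀ x, 0 ≤ h x) (h1 : ∀ x, h x ≤ 1) {S : Set ℝ} {a b : ℝ}
    (hS : S ⊆ Set.Ico a b) (x : ℝ) :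
    |densityDefect h S a b x| ≤ (Set.Ico a b).indicator (fun _ ↦ 1) x := by
  unfold densityDefect
  by_cases hx : x ∈ Set.Ico a b
  · have := h0 x
    have := h1 x
    by_cases hxS : x ∈ S
    · simp only [hxS, hx, Set.indicator_of_mem]
      rw [abs_le]
      constructor <;> linarith
    · simp only [hxS, hx, Set.indicator_of_mem, not_false_eq_true, Set.indicator_of_notMem]
      rw [abs_le]
      constructor <;> linarith
  · have hxS : x ∉ S := fun h ↦ hx (hS h)
    simp [hx, hxS]

theorem abs_densityDefect_le_one (h0 : ∀ x, 0 ≤ h x) (h1 : ∀ x, h x ≤ 1) {S : Set ℝ} {a b : ℝ}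
    (hS : S ⊆ Set.Ico a b) (x : ℝ) : |densityDefect h S a b x| ≤ 1 :=
  (abs_densityDefect_le h0 h1 hS x).trans (Set.indicator_le_self' (by simp) x)

theorem densityDefect_of_notMem {S : Set ℝ} {a b : ℝ} (hS : S ⊆ Set.Ico a b) {x : ℝ}
    (hx : x ∉ Set.Ico a b) : densityDefect h S a b x = 0 := by
  have hxS : x ∉ S := fun h ↦ hx (hS h)
  simp [densityDefect, hx, hxS]

theorem measurable_densityDefect (hh : Continuous h) {S : Set ℝ} (hSm : MeasurableSet S)
    (a b : ℝ) : Measurable (densityDefect h S a b) :=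
  (measurable_const.indicator hSm).sub (hh.measurable.indicator measurableSet_Ico)

theorem integrable_densityDefect (hh : Continuous h) (h0 : ∀ x, 0 ≤ h x) (h1 : ∀ x, h x ≤ 1)
    {S : Set ℝ} (hSm : MeasurableSet S) {a b : ℝ} (hS : S ⊆ Set.Ico a b) :
    Integrable (densityDefect h S a b) := by
  refine Integrable.mono' (g := (Set.Ico a b).indicator fun _ ↦ 1) ?_
    (measurable_densityDefect hh hSm a b).aestronglyMeasurable
    (ae_of_all _ fun x ↦ abs_densityDefect_le h0 h1 hS x)
  exact (integrable_indicator_iff measurableSet_Ico).mpr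
    (integrableOn_const (by simp))

theorem integral_abs_densityDefect_le (hh : Continuous h) (h0 : ∀ x, 0 ≤ h x)
    (h1 : ∀ x, h x ≤ 1) {S : Set ℝ} (hSm : MeasurableSet S) {a b : ℝ} (hab : a ≤ b)
    (hS : S ⊆ Set.Ico a b) : ∫ x, |densityDefect h S a b x| ≤ b - a := by
  have hi : Integrable ((Set.Ico a b).indicator fun _ ↦ (1 : ℝ)) :=
    (integrable_indicator_iff measurableSet_Ico).mpr (integrableOn_const (by simp))
  calc ∫ x, |densityDefect h S a b x| ≤ ∫ x, (Set.Ico a b).indicator (fun _ ↦ (1 : ℝ)) x :=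
        integral_mono (integrable_densityDefect hh h0 h1 hSm hS).abs hi
          (abs_densityDefect_le h0 h1 hS)
    _ = b - a := by
        rw [integral_indicator_const _ measurableSet_Ico]
        simp [hab]

theorem continuousAt_indicator_Ico {g : ℝ → ℝ} (hg : Continuous g) {a b x : ℝ} (ha : x ≠ a)
    (hb : x ≠ b) : ContinuousAt ((Set.Ico a b).indicator g) x := by
  by_cases hx : x ∈ Set.Ioo a b
  · refine hg.continuousAt.congr ?_
    filter_upwards [isOpen_Ioo.mem_nhds hx] with y hy
    rw [Set.indicator_of_mem (Set.Ioo_subset_Ico_self hy)]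
  · have hx' : x ∈ (Set.Icc a b)ᶜ := by
      intro hx2
      exact hx ⟨lt_of_le_of_ne hx2.1 ha.symm, lt_of_le_of_ne hx2.2 hb⟩
    refine (continuousAt_const (y := (0 : ℝ))).congr ?_
    filter_upwards [isClosed_Icc.isOpen_compl.mem_nhds hx'] with y hy
    rw [Set.indicator_of_notMem fun h ↦ hy (Set.Ico_subset_Icc_self h)]

theorem ae_continuousAt_densityDefect_Ico (hh : Continuous h) (a b c : ℝ) :
    ∀ᵐ x, ContinuousAt (densityDefect h (Set.Ico a c) a b) x := by
  have hfin : volume ({a, b, c} : Set ℝ) = 0 := (Set.toFinite _).measure_zero _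
  filter_upwards [compl_mem_ae_iff.mpr hfin] with x hx
  simp only [Set.mem_compl_iff, Set.mem_insert_iff, Set.mem_singleton_iff, not_or] at hx
  exact (continuousAt_indicator_Ico continuous_const hx.1 hx.2.2).sub
    (continuousAt_indicator_Ico hh hx.1 hx.2.1)

/-- Mean zero allows subtracting from the character its value at `b`; it varies by at most `2π|ξ|δ`
over the cell, and `f` has mass at most `δ`. -/
theorem norm_fourier_le_of_integral_eq_zero {f : ℝ → ℝ} (hf : Integrable f)
    (hf0 : ∫ x, f x = 0) {b δ : ℝ} (hδ : 0 ≤ δ)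
    (hfb : ∀ x, |f x| ≤ (Set.Ico b (b + δ)).indicator (fun _ ↦ 1) x) (ξ : ℝ) :
    ‖𝓕 (fun x ↦ (f x : ℂ)) ξ‖ ≤ 2 * π * |ξ| * δ ^ 2 := by
  have hi : Integrable ((Set.Ico b (b + δ)).indicator fun _ ↦ (2 * π * |ξ| * δ : ℝ)) :=
    (integrable_indicator_iff measurableSet_Ico).mpr (integrableOn_const (by simp))
  have hexp : ∀ x : ℝ, cexp (↑(-2 * π * x * ξ) * I) - cexp (↑(-2 * π * b * ξ) * I) =
      cexp (↑(-2 * π * b * ξ) * I) * (cexp (I * (-2 * π * (x - b) * ξ : ℝ)) - 1) := by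
    intro x
    rw [mul_sub, ← Complex.exp_add, mul_one]
    congr 2
    push_cast
    ring
  have hF : 𝓕 (fun x ↦ (f x : ℂ)) ξ =
      ∫ x, (cexp (↑(-2 * π * x * ξ) * I) - cexp (↑(-2 * π * b * ξ) * I)) * (f x : ℂ) := by
    simp_rw [sub_mul]
    rw [integral_sub, integral_const_mul, integral_complex_ofReal, hf0,
      Real.fourier_real_eq_integral_exp_smul]
    · simp
    · refine hf.ofReal.bdd_mul (c := 1) (by fun_prop) (ae_of_all _ fun x ↦ ?_)
      rw [Complex.norm_exp_ofReal_mul_I]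
    · exact hf.ofReal.const_mul _
  rw [hF]
  refine (norm_integral_le_of_norm_le hi (ae_of_all _ fun x ↦ ?_)).trans_eq ?_
  · rw [norm_mul, hexp, norm_mul, Complex.norm_exp_ofReal_mul_I, one_mul, Complex.norm_real,
      Real.norm_eq_abs]
    have h1 := hfb x
    by_cases hx : x ∈ Set.Ico b (b + δ)
    · rw [Set.indicator_of_mem hx] at h1 ⊢
      refine (mul_le_of_le_one_right (norm_nonneg _) h1).trans
        (norm_exp_I_mul_ofReal_sub_one_le.trans ?_)
      rw [Real.norm_eq_abs, abs_mul, abs_mul, abs_mul, abs_neg, abs_two, abs_of_pos pi_pos,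
        abs_of_nonneg (by linarith [hx.1] : 0 ≤ x - b), mul_right_comm]
      gcongr
      linarith [hx.2]
    · rw [Set.indicator_of_notMem hx] at h1 ⊢
      rw [le_antisymm h1 (abs_nonneg _), mul_zero]
  · rw [integral_indicator_const _ measurableSet_Ico]
    simp [hδ]
    ring

theorem integral_densityDefect_cell (hh : Continuous h) (h0 : ∀ x, 0 ≤ h x) {a b : ℝ}
    (hab : a ≤ b) :
    ∫ x, densityDefect h (Set.Ico a (a + ∫ x in a..b, h x)) a b x = 0 := by
  unfold densityDefect
  rw [integral_sub, integral_indicator_const _ measurableSet_Ico,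
    integral_indicator measurableSet_Ico, integral_Ico_eq_integral_Ioc,
    ← intervalIntegral.integral_of_le hab]
  · simp [intervalIntegral.integral_nonneg hab fun x _ ↦ h0 x]
  · exact (integrable_indicator_iff measurableSet_Ico).mpr (integrableOn_const (by simp))
  · exact (integrable_indicator_iff measurableSet_Ico).mpr
      ((hh.integrableOn_Icc).mono_set Set.Ico_subset_Icc_self)

/-- The density `h` can be approximated by a set in `N` consecutive cells of length `δ`. -/
theorem exists_set_fourier_densityDefect_le (hh : Continuous h) (h0 : ∀ x, 0 ≤ h x)
    (h1 : ∀ x, h x ≤ 1) (a : ℝ) {δ : ℝ} (hδ : 0 ≤ δ) (N : ℕ) :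
    ∃ S ⊆ Set.Ico a (a + N * δ), MeasurableSet S ∧
      (∀ᵐ x, ContinuousAt (densityDefect h S a (a + N * δ)) x) ∧
      ∀ ξ, ‖𝓕 (fun x ↦ (densityDefect h S a (a + N * δ) x : ℂ)) ξ‖ ≤
        N * (2 * π * |ξ| * δ ^ 2) := by
  induction N with
  | zero =>
    refine ⟨∅, by simp, MeasurableSet.empty, ?_, fun ξ ↦ ?_⟩
    · have : densityDefect h ∅ a (a + (0 : ℕ) * δ) = fun _ ↦ 0 := by
        ext x; simp [densityDefect]
      rw [this]
      exact ae_of_all _ fun x ↦ continuousAt_const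
    · have : (fun x ↦ (densityDefect h ∅ a (a + (0 : ℕ) * δ) x : ℂ)) = fun _ ↦ 0 := by
        ext x; simp [densityDefect]
      rw [this, Real.fourier_real_eq_integral_exp_smul]
      simp
  | succ N ih =>
    obtain ⟨S, hS, hSm, hSc, hSF⟩ := ih
    set b : ℝ := a + N * δ with hb
    have hab : a ≤ b := le_add_of_nonneg_right (by positivity)
    have hb' : a + (N + 1 : ℕ) * δ = b + δ := by rw [hb]; push_cast; ring
    have hbδ : b ≤ b + δ := by linarith
    -- The length of this interval is the mass of `h` in the new cell, so the new defect has mean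
    -- zero.
    set T : Set ℝ := Set.Ico b (b + ∫ x in b..b + δ, h x) with hT
    have hint : ∫ x in b..b + δ, h x ≤ δ := by
      calc ∫ x in b..b + δ, h x ≤ ∫ x in b..b + δ, (1 : ℝ) :=
            intervalIntegral.integral_mono_on hbδ (hh.intervalIntegrable _ _) (by simp)
              fun x _ ↦ h1 x
        _ = δ := by simp
    have hTs : T ⊆ Set.Ico b (b + δ) := Set.Ico_subset_Ico_right (by linarith)
    have hsum : ∀ x, densityDefect h (S ∪ T) a (b + δ) x =
        densityDefect h S a b x + densityDefect h T b (b + δ) x := by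
      intro x
      unfold densityDefect
      have hd1 : Disjoint S T := (Set.Ico_disjoint_Ico_same (a := a) (b := b)
        (c := b + δ)).mono hS hTs
      rw [Set.indicator_union_of_disjoint hd1, ← Set.Ico_union_Ico_eq_Ico hab hbδ,
        Set.indicator_union_of_disjoint (Set.Ico_disjoint_Ico_same)]
      ring
    rw [hb']
    refine ⟨S ∪ T, ?_, hSm.union measurableSet_Ico, ?_, fun ξ ↦ ?_⟩
    · rw [← Set.Ico_union_Ico_eq_Ico hab hbδ]
      exact Set.union_subset_union hS hTs
    · rw [funext hsum]
      filter_upwards [hSc, ae_continuousAt_densityDefect_Ico hh b (b + δ)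
        (b + ∫ x in b..b + δ, h x)] with x hx1 hx2
      exact hx1.add hx2
    · have hi1 := integrable_densityDefect hh h0 h1 hSm hS
      have hi2 := integrable_densityDefect hh h0 h1 (measurableSet_Ico : MeasurableSet T) hTs
      have hadd : 𝓕 (fun x ↦ (densityDefect h (S ∪ T) a (b + δ) x : ℂ)) ξ =
          𝓕 (fun x ↦ (densityDefect h S a b x : ℂ)) ξ +
            𝓕 (fun x ↦ (densityDefect h T b (b + δ) x : ℂ)) ξ := by
        have := congrFun (VectorFourier.fourierIntegral_add (L := innerₗ ℝ)
          Real.continuous_fourierChar continuous_inner hi1.ofReal (𝕜 := ℝ) (E := ℂ) hi2.ofReal) ξ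
        simp_rw [hsum, Complex.ofReal_add]
        exact this
      rw [hadd]
      refine (norm_add_le _ _).trans ?_
      have := norm_fourier_le_of_integral_eq_zero hi2 (integral_densityDefect_cell hh h0 hbδ) hδ
        (abs_densityDefect_le h0 h1 hTs) ξ
      have := hSF ξ
      push_cast
      linarith

/-- On a unit interval a density can be replaced by a set so that the error, integrated against
the dilates of `μ`, is a Lipschitz function of the translation with small constant. -/
theorem exists_set_abs_integral_densityDefect_le {μ : Measure ℝ} [IsFiniteMeasure μ]
    (hac : μ ≪ volume) (hμ : sobolevEnergy μ ≠ ⊤) (hh : Continuous h) (h0 : ∀ x, 0 ≤ h x)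
    (h1 : ∀ x, h x ≤ 1) (a : ℝ) {η : ℝ} (hη : 0 < η) :
    ∃ S ⊆ Set.Ico a (a + 1), MeasurableSet S ∧ ∀ r : ℝ, 0 < r → ∀ t t' : ℝ,
      |(∫ s, densityDefect h S a (a + 1) (r * s + t') ∂μ) -
        ∫ s, densityDefect h S a (a + 1) (r * s + t) ∂μ| ≤ η * (r ^ 2)⁻¹ * |t' - t| := by
  -- Dividing by `2 * π` compensates for the factor in the Lipschitz estimate.
  obtain ⟨δ, hδ, H⟩ := exists_forall_lintegral_frequency_le (μ := μ) hμ
    (η := η / (2 * π)) (by positivity)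
  -- The bounds for `N` cells of length `1 / N` add up to `2π|ξ| / N`, which is then at most `δ|ξ|`.
  obtain ⟨N, hN⟩ := exists_nat_gt (2 * π / δ)
  have hN0 : (0 : ℝ) < N := lt_trans (by positivity) hN
  obtain ⟨S, hS, hSm, hSc, hSF⟩ := exists_set_fourier_densityDefect_le hh h0 h1 a
    (δ := 1 / N) (by positivity) N
  have hN1 : (N : ℝ) * (1 / N) = 1 := by field_simp
  rw [hN1] at hS hSc hSF
  refine ⟨S, hS, hSm, fun r hr t t' ↦ ?_⟩
  set f := densityDefect h S a (a + 1) with hf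
  have hfi : Integrable f := integrable_densityDefect hh h0 h1 hSm hS
  have hf1 : ∀ x, |f x| ≤ 1 := abs_densityDefect_le_one h0 h1 hS
  have hfF : ∀ ξ, ‖𝓕 (fun x ↦ (f x : ℂ)) ξ‖ ≤ δ * |ξ| := by
    intro ξ
    refine (hSF ξ).trans ?_
    have e : (N : ℝ) * (2 * π * |ξ| * (1 / N) ^ 2) = 2 * π / N * |ξ| := by field_simp
    rw [e]
    gcongr
    rw [div_le_iff₀ hN0]
    rw [div_lt_iff₀ hδ] at hN
    linarith
  have hfint : ∫ x, |f x| ≤ 1 := by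
    have := integral_abs_densityDefect_le hh h0 h1 hSm (by linarith : a ≤ a + 1) hS
    linarith
  have h3 := H f hfi hf1 hfint hfF r hr
  have h4 := enorm_integral_affine_sub_le hac (f := fun x ↦ (f x : ℂ)) hfi.ofReal
    (fun x ↦ by simpa using hf1 x) (by
      filter_upwards [hSc] with x hx
      exact Complex.continuous_ofReal.continuousAt.comp hx) hr t t'
  have h5 := h4.trans (mul_le_mul_right h3 _)
  rw [integral_complex_ofReal, integral_complex_ofReal, ← Complex.ofReal_sub,
    ← ENNReal.ofReal_mul (by positivity), ← _root_.ofReal_norm, Complex.norm_real,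
    Real.norm_eq_abs, ENNReal.ofReal_le_ofReal_iff (by positivity)] at h5
  refine h5.trans_eq ?_
  field_simp

end Discretization

/-! ### A set on the line whose mass is strictly monotone under translation. -/

section TranslatesOnTheLine

open Filter Real

/-- A smooth strictly increasing density with values in `[0, 1]`. -/
noncomputable def arctanDensity (x : ℝ) : ℝ := 1 / 2 + arctan x / π

theorem continuous_arctanDensity : Continuous arctanDensity := by
  unfold arctanDensity
  have := continuous_arctan
  fun_prop

theorem arctanDensity_nonneg (x : ℝ) : 0 ≤ arctanDensity x := by
  have h : -(1 / 2) ≤ arctan x / π := by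
    rw [le_div_iff₀ pi_pos]
    linarith [neg_pi_div_two_lt_arctan x]
  unfold arctanDensity
  linarith

theorem arctanDensity_le_one (x : ℝ) : arctanDensity x ≤ 1 := by
  have h : arctan x / π ≤ 1 / 2 := by
    rw [div_le_iff₀ pi_pos]
    linarith [arctan_lt_pi_div_two x]
  unfold arctanDensity
  linarith

/-- On `[-M, M]` the derivative `1 / (π (1 + z²))` is smallest at the ends. Its merely quadratic
decay is what the factor `r⁻²` in the error can match. -/
theorem mul_sub_le_arctanDensity_sub {M x y : ℝ} (hx : -M ≤ x) (hxy : x ≤ y) (hy : y ≤ M) :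
    (π * (1 + M ^ 2))⁻¹ * (y - x) ≤ arctanDensity y - arctanDensity x := by
  have hd : ∀ z, HasDerivAt arctanDensity (1 / (1 + z ^ 2) / π) z := fun z ↦
    ((hasDerivAt_arctan z).div_const π).const_add (1 / 2)
  refine (convex_Icc (-M) M).mul_sub_le_image_sub_of_le_deriv
    continuous_arctanDensity.continuousOn
    (fun z _ ↦ (hd z).differentiableAt.differentiableWithinAt) ?_ x ⟨hx, hxy.trans hy⟩ y
    ⟨hx.trans hxy, hy⟩ hxy
  intro z hz
  rw [interior_Icc] at hz
  rw [(hd z).deriv, div_div, one_div, mul_comm _ π]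
  have := sq_le_sq' hz.1.le hz.2.le
  exact inv_anti₀ (by positivity) (mul_le_mul_of_nonneg_left (by linarith) pi_pos.le)

/-- Restricting to steps of length at most one keeps all points in a bounded window, where finitely
many cells and a single slope bound suffice. -/
theorem strictMono_of_lt_of_le_add_one {f : ℝ → ℝ}
    (h : ∀ t t' : ℝ, t < t' → t' ≤ t + 1 → f t < f t') : StrictMono f := by
  have step : ∀ n : ℕ, ∀ t t' : ℝ, t < t' → t' ≤ t + (n + 1) → f t < f t' := by
    intro n
    induction n with
    | zero => intro t t' h1 h2; exact h t t' h1 (by simpa using h2)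
    | succ n ih =>
      intro t t' h1 h2
      by_cases h3 : t' ≤ t + 1
      · exact h t t' h1 h3
      · push Not at h3
        push_cast at h2
        exact (h t (t + 1) (by linarith) le_rfl).trans (ih _ _ h3 (by linarith))
  intro t t' h1
  obtain ⟨n, hn⟩ := exists_nat_gt (t' - t)
  exact step n t t' h1 (by linarith)

/-- The translates of all the dilates of a sufficiently regular measure on the line are
distinguished by their values on one set. -/
theorem exists_measurableSet_strictMono_measure {μ : Measure ℝ} [IsFiniteMeasure μ]
    (hac : μ ≪ volume) (hμ : sobolevEnergy μ ≠ ⊤) (hμ0 : μ ≠ 0) {R : ℝ} (hR : 0 ≤ R)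
    (hsupp : ∀ᵐ s ∂μ, |s| ≤ R) :
    ∃ S, MeasurableSet S ∧ ∀ r : ℝ, 1 ≤ r →
      StrictMono fun t ↦ μ.real ((fun s ↦ r * s + t) ⁻¹' S) := by
  set m := μ.real Set.univ with hm
  have hm0 : 0 < m := by
    exact ENNReal.toReal_pos (Measure.measure_univ_ne_zero.mpr hμ0) (measure_ne_top _ _)
  -- The `w k` share out the error budget: cell `k` may use the fraction `w k` of the main slope,
  -- and the fractions sum to less than `1`. The constant in `η k` bounds that slope from below, up
  -- to `r⁻²`, whenever cell `k` can be met.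
  obtain ⟨w, hw0, wc, hws, hwc⟩ := NNReal.exists_pos_sum_of_countable (ε := 1) one_ne_zero ℤ
  set η : ℤ → ℝ := fun k ↦ w k * (m * (π * (1 + (|(k : ℝ)| + 2 * R + 5) ^ 2))⁻¹) with hη
  have hη0 : ∀ k, 0 < η k := by
    intro k
    have := hw0 k
    positivity
  have hc := continuous_arctanDensity
  choose S hS hSm HS using fun k : ℤ ↦ exists_set_abs_integral_densityDefect_le hac hμ
    continuous_arctanDensity arctanDensity_nonneg arctanDensity_le_one (k : ℝ) (hη0 k)
  set ψ : ℤ → ℝ → ℝ := fun k ↦ densityDefect arctanDensity (S k) k (k + 1) with hψ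
  have hψ1 : ∀ k x, |ψ k x| ≤ 1 := fun k x ↦
    abs_densityDefect_le_one arctanDensity_nonneg arctanDensity_le_one (hS k) x
  have hψm : ∀ k, Measurable (ψ k) := fun k ↦ measurable_densityDefect hc (hSm k) _ _
  have hUm : MeasurableSet (⋃ k, S k) := MeasurableSet.iUnion hSm
  have hfloor : ∀ (k : ℤ) (x : ℝ), x ∈ Set.Ico (k : ℝ) (k + 1) ↔ ⌊x⌋ = k := fun k x ↦
    Int.floor_eq_iff.symm
  have hmem : ∀ x, x ∈ ⋃ k, S k ↔ x ∈ S ⌊x⌋ := by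
    intro x
    refine ⟨fun hx ↦ ?_, fun hx ↦ Set.mem_iUnion_of_mem _ hx⟩
    obtain ⟨k, hk⟩ := Set.mem_iUnion.mp hx
    rwa [(hfloor k x).mp (hS k hk)]
  -- At each point only the cell containing it contributes to the sum.
  have hdecomp : ∀ (n : ℕ) (x : ℝ), |x| ≤ n → (⋃ k, S k).indicator (fun _ ↦ (1 : ℝ)) x =
      arctanDensity x + ∑ k ∈ Finset.Icc (-(n : ℤ)) n, ψ k x := by
    intro n x hx
    have hx2 := abs_le.mp hx
    rw [Finset.sum_eq_single ⌊x⌋]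
    · have hx1 : x ∈ Set.Ico (⌊x⌋ : ℝ) (⌊x⌋ + 1) := (hfloor _ _).mpr rfl
      simp only [hψ, densityDefect]
      rw [Set.indicator_of_mem hx1]
      have : (⋃ k, S k).indicator (fun _ ↦ (1 : ℝ)) x =
          (S ⌊x⌋).indicator (fun _ ↦ (1 : ℝ)) x := by
        by_cases h : x ∈ S ⌊x⌋
        · rw [Set.indicator_of_mem h, Set.indicator_of_mem ((hmem x).mpr h)]
        · rw [Set.indicator_of_notMem h, Set.indicator_of_notMem fun h' ↦ h ((hmem x).mp h')]
      rw [this]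
      ring
    · intro k _ hk
      exact densityDefect_of_notMem (hS k) fun h ↦ hk ((hfloor k x).mp h).symm
    · intro h
      refine absurd (Finset.mem_Icc.mpr ⟨?_, ?_⟩) h
      · rw [Int.le_floor]; push_cast; linarith
      · have := Int.floor_le x
        exact_mod_cast this.trans hx2.2
  refine ⟨⋃ k, S k, hUm, fun r hr ↦ strictMono_of_lt_of_le_add_one fun t t' htt ht1 ↦ ?_⟩
  have hr0 : 0 < r := by linarith
  have hrR : 0 ≤ r * R := by positivity
  have hbdd : ∀ u : ℝ, Measurable fun s ↦ r * s + u := fun u ↦ by fun_prop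
  obtain ⟨n, hn⟩ := exists_nat_ge (|t| + 1 + r * R)
  set M := |t| + 1 + r * R with hM
  have hM0 : 0 < M := by positivity
  have hMbound : ∀ s u : ℝ, |s| ≤ R → t ≤ u → u ≤ t + 1 → |r * s + u| ≤ M := by
    intro s u hs h1 h2
    have e1 : |r * s| ≤ r * R := by
      rw [abs_mul, abs_of_pos hr0]
      gcongr
    have e2 := abs_le.mp e1
    have e3 := neg_abs_le t
    have e4 := le_abs_self t
    rw [abs_le]
    constructor <;> linarith
  have hint : ∀ (k : ℤ) (u : ℝ), Integrable (fun s ↦ ψ k (r * s + u)) μ := fun k u ↦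
    (integrable_const (1 : ℝ)).mono' ((hψm k).comp (hbdd u)).aestronglyMeasurable
      (ae_of_all _ fun s ↦ hψ1 k _)
  have hinta : ∀ u : ℝ, Integrable (fun s ↦ arctanDensity (r * s + u)) μ := fun u ↦ by
    refine (integrable_const (1 : ℝ)).mono'
      (hc.measurable.comp (hbdd u)).aestronglyMeasurable (ae_of_all _ fun s ↦ ?_)
    rw [Real.norm_of_nonneg (arctanDensity_nonneg _)]
    exact arctanDensity_le_one _
  have hval : ∀ u, t ≤ u → u ≤ t + 1 → μ.real ((fun s ↦ r * s + u) ⁻¹' ⋃ k, S k) =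
      (∫ s, arctanDensity (r * s + u) ∂μ) +
        ∑ k ∈ Finset.Icc (-(n : ℤ)) n, ∫ s, ψ k (r * s + u) ∂μ := by
    intro u h1 h2
    rw [← integral_finsetSum _ fun k _ ↦ hint k u,
      ← integral_add (hinta u) (integrable_finsetSum _ fun k _ ↦ hint k u),
      ← integral_indicator_one (hUm.preimage (hbdd u))]
    refine integral_congr_ae ?_
    filter_upwards [hsupp] with s hs
    rw [← hdecomp n _ ((hMbound s u hs h1 h2).trans hn)]
    rfl
  set c := m * (π * (1 + M ^ 2))⁻¹ with hcdef
  have hc0 : 0 < c := by positivity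
  have hmain : c * (t' - t) ≤
      (∫ s, arctanDensity (r * s + t') ∂μ) - ∫ s, arctanDensity (r * s + t) ∂μ := by
    rw [← integral_sub (hinta t') (hinta t)]
    have e : c * (t' - t) = ∫ _, (π * (1 + M ^ 2))⁻¹ * (t' - t) ∂μ := by
      rw [integral_const, smul_eq_mul, hcdef, hm]
      ring
    rw [e]
    refine integral_mono_ae (integrable_const _) ((hinta t').sub (hinta t)) ?_
    filter_upwards [hsupp] with s hs
    have h1 := abs_le.mp (hMbound s t hs le_rfl (by linarith))
    have h2 := abs_le.mp (hMbound s t' hs htt.le ht1)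
    have := mul_sub_le_arctanDensity_sub (M := M) h1.1 (by linarith : r * s + t ≤ r * s + t')
      h2.2
    simpa using this
  have herr : ∀ k : ℤ, |(∫ s, ψ k (r * s + t') ∂μ) - ∫ s, ψ k (r * s + t) ∂μ| ≤
      w k * (c * (t' - t)) := by
    intro k
    -- A cell this far away is never reached by `r * s + u` with `|s| ≤ R`. Otherwise `|t| ≤ |k| + 2
    -- + r * R`, so `M ≤ r * (|k| + 2 * R + 5)` because `r ≥ 1`, and `η k * r⁻²` stays below `w k *
    -- c`.
    by_cases hk : |(k : ℝ)| + 1 < |t| - 1 - r * R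
    · have hz : ∀ u, t ≤ u → u ≤ t + 1 → ∫ s, ψ k (r * s + u) ∂μ = 0 := by
        intro u h1 h2
        rw [← integral_zero ℝ ℝ (μ := μ)]
        refine integral_congr_ae ?_
        filter_upwards [hsupp] with s hs
        refine densityDefect_of_notMem (hS k) fun hx ↦ ?_
        have e1 : |r * s| ≤ r * R := by
          rw [abs_mul, abs_of_pos hr0]
          gcongr
        have e2 := abs_le.mp e1
        have e3 := abs_le.mp (le_refl |(k : ℝ)|)
        have e4 : |t| ≤ |(k : ℝ)| + 2 + r * R := by
          rw [abs_le]
          constructor <;> linarith [hx.1, hx.2]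
        linarith
      rw [hz t' htt.le ht1, hz t le_rfl (by linarith)]
      have := (hw0 k).le
      have : 0 ≤ t' - t := by linarith
      simp only [sub_self, abs_zero]
      positivity
    · push Not at hk
      refine (HS k r hr0 t t').trans ?_
      rw [abs_of_pos (by linarith : 0 < t' - t), ← mul_assoc]
      have hMle : M ≤ r * (|(k : ℝ)| + 2 * R + 5) := by
        have := abs_nonneg (k : ℝ)
        nlinarith
      have hle : η k * (r ^ 2)⁻¹ ≤ w k * c := by
        rw [hη, hcdef, mul_assoc, mul_assoc]
        gcongr
        rw [← mul_inv]
        have h1 : 1 + M ^ 2 ≤ r ^ 2 + (r * (|(k : ℝ)| + 2 * R + 5)) ^ 2 := by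
          gcongr
          nlinarith
        have h2 : r ^ 2 + (r * (|(k : ℝ)| + 2 * R + 5)) ^ 2 =
            (1 + (|(k : ℝ)| + 2 * R + 5) ^ 2) * r ^ 2 := by ring
        rw [mul_assoc, ← h2]
        gcongr
      exact mul_le_mul_of_nonneg_right hle (by linarith)
  have hwsum : ∑ k ∈ Finset.Icc (-(n : ℤ)) n, (w k : ℝ) < 1 := by
    have h1 : ∑ k ∈ Finset.Icc (-(n : ℤ)) n, w k ≤ wc := sum_le_hasSum _ (by simp) hws
    exact_mod_cast h1.trans_lt hwc
  have hsum : |∑ k ∈ Finset.Icc (-(n : ℤ)) n,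
      ((∫ s, ψ k (r * s + t') ∂μ) - ∫ s, ψ k (r * s + t) ∂μ)| < c * (t' - t) := by
    refine (Finset.abs_sum_le_sum_abs _ _).trans_lt ?_
    refine (Finset.sum_le_sum fun k _ ↦ herr k).trans_lt ?_
    rw [← Finset.sum_mul]
    have : 0 < c * (t' - t) := mul_pos hc0 (by linarith)
    exact mul_lt_of_lt_one_left this hwsum
  rw [Finset.sum_sub_distrib] at hsum
  have h1 := (abs_lt.mp hsum).1
  simp only [hval t le_rfl (by linarith), hval t' htt.le ht1]
  linarith

end TranslatesOnTheLine

/-! ### Directions in which the marginal has finite energy. -/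

section GoodDirections

open Filter Complex Module Real
open scoped Topology FourierTransform RealInnerProductSpace

variable {V : Type*} [NormedAddCommGroup V] [InnerProductSpace ℝ V]
  [MeasurableSpace V] [BorelSpace V] [FiniteDimensional ℝ V]

theorem charFun_restrict_eq_fourier {E : Set V} (hE : MeasurableSet E) (x : V) :
    charFun (volume.restrict E) x =
      𝓕 (fun y ↦ ((E.indicator (fun _ ↦ 1) y : ℝ) : ℂ)) (-(2 * π)⁻¹ • x) := by
  rw [charFun_apply, Real.fourier_eq', ← integral_indicator hE]
  congr with y
  by_cases hy : y ∈ E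
  · simp only [hy, Set.indicator_of_mem, inner_smul_right, Complex.ofReal_one, smul_eq_mul,
      mul_one]
    congr 2
    push_cast
    field_simp
  · simp [hy]

theorem lintegral_comp_smul {G : V → ENNReal} (hG : Measurable G) {a : ℝ} (ha : a ≠ 0) :
    ∫⁻ x, G (a • x) = ENNReal.ofReal |(a ^ finrank ℝ V)⁻¹| * ∫⁻ x, G x := by
  rw [← lintegral_map hG (measurable_const_smul a), Measure.map_addHaar_smul volume ha,
    lintegral_smul_measure, smul_eq_mul]

theorem lintegral_charFun_restrict_sq_ne_top {E : Set V} (hE : MeasurableSet E)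
    (hfin : volume E ≠ ⊤) :
    ∫⁻ x, ‖charFun (volume.restrict E) x‖ₑ ^ 2 ≠ ⊤ := by
  have hi : Integrable (E.indicator (fun _ ↦ (1 : ℝ))) :=
    (integrable_indicator_iff hE).mpr (integrableOn_const hfin)
  have hb : ∀ x, |E.indicator (fun _ ↦ (1 : ℝ)) x| ≤ 1 := by
    intro x
    by_cases hx : x ∈ E <;> simp [hx]
  have hF := continuous_fourier_of_integrable hi.ofReal (V := V)
  have h := lintegral_enorm_fourier_sq_le hi hb
  simp_rw [charFun_restrict_eq_fourier hE]
  rw [lintegral_comp_smul (G := fun x ↦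
    ‖𝓕 (fun y ↦ ((E.indicator (fun _ ↦ 1) y : ℝ) : ℂ)) x‖ₑ ^ 2) (by fun_prop)
    (by simp [pi_ne_zero])]
  exact ENNReal.mul_ne_top ENNReal.ofReal_ne_top (ne_top_of_le_ne_top ENNReal.ofReal_ne_top h)

/-- The measure `dξ / |ξ|` is scale invariant, so the bound is free of `R`. It limits the total
weight a point receives in the polar coordinate argument. -/
theorem lintegral_inv_annulus_le (R : ℝ) :
    ∫⁻ ξ : ℝ, ENNReal.ofReal |ξ|⁻¹ * {ξ : ℝ | |ξ| < R ∧ R < 2 * |ξ|}.indicator 1 ξ ≤ 4 := by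
  rcases le_or_gt R 0 with hR | hR
  · have : {ξ : ℝ | |ξ| < R ∧ R < 2 * |ξ|} = ∅ := by
      ext ξ
      simp only [Set.mem_ofPred_eq, Set.mem_empty_iff_false, iff_false]
      intro h
      linarith [abs_nonneg ξ]
    simp [this]
  · calc ∫⁻ ξ : ℝ, ENNReal.ofReal |ξ|⁻¹ * {ξ : ℝ | |ξ| < R ∧ R < 2 * |ξ|}.indicator 1 ξ
        ≤ ∫⁻ ξ : ℝ, (Set.Icc (-R) R).indicator (fun _ ↦ ENNReal.ofReal (2 / R)) ξ := by
          refine lintegral_mono fun ξ ↦ ?_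
          by_cases hξ : ξ ∈ {ξ : ℝ | |ξ| < R ∧ R < 2 * |ξ|}
          · have hξ2 : ξ ∈ Set.Icc (-R) R := abs_le.mp hξ.1.le
            have h3 := hξ.2
            rw [Set.indicator_of_mem hξ, Set.indicator_of_mem hξ2, Pi.one_apply, mul_one]
            apply ENNReal.ofReal_le_ofReal
            have : 0 < |ξ| := by linarith
            rw [inv_eq_one_div, div_le_div_iff₀ this hR]
            linarith
          · rw [Set.indicator_of_notMem hξ, mul_zero]
            exact zero_le
      _ = 4 := by
          rw [lintegral_indicator_const measurableSet_Icc, Real.volume_Icc,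
            ← ENNReal.ofReal_mul (by positivity)]
          have : 2 / R * (R - -R) = 4 := by field_simp; ring
          rw [this]
          simp

/-- Integration in polar coordinates: along almost every direction an integrable function is
integrable with the radial weight. -/
theorem ae_lintegral_radial_ne_top {G : V → ENNReal} (hG : Measurable G)
    (hfin : ∫⁻ x, G x ≠ ⊤) {m : ℕ} (hm : finrank ℝ V = m + 1) :
    ∀ᵐ v : V, 1 < ‖v‖ ∧ ‖v‖ < 2 → ∫⁻ ξ : ℝ, ‖ξ‖ₑ ^ m * G (ξ • v) ≠ ⊤ := by
  set A : Set V := {v | 1 < ‖v‖ ∧ ‖v‖ < 2} with hA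
  have hAm : MeasurableSet A := (isOpen_lt continuous_const continuous_norm).measurableSet.inter
    (isOpen_lt continuous_norm continuous_const).measurableSet
  have hAi : Measurable (A.indicator (1 : V → ENNReal)) := measurable_one.indicator hAm
  have hmeas : Measurable fun p : V × ℝ ↦
      A.indicator 1 p.1 * (‖p.2‖ₑ ^ m * G (p.2 • p.1)) :=
    (hAi.comp measurable_fst).mul ((by fun_prop : Measurable fun p : V × ℝ ↦ ‖p.2‖ₑ ^ m).mul
      (hG.comp (measurable_snd.smul measurable_fst)))
  have hmeas2 : Measurable fun p : ℝ × V ↦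
      ENNReal.ofReal |p.1|⁻¹ * (A.indicator 1 (p.1⁻¹ • p.2) * G p.2) :=
    (by fun_prop : Measurable fun p : ℝ × V ↦ ENNReal.ofReal |p.1|⁻¹).mul
      ((hAi.comp (measurable_fst.inv.smul measurable_snd)).mul (hG.comp measurable_snd))
  have htot : ∫⁻ v : V, ∫⁻ ξ : ℝ, A.indicator 1 v * (‖ξ‖ₑ ^ m * G (ξ • v)) ≤
      4 * ∫⁻ x, G x := by
    -- Directions range over the shell `1 < ‖v‖ < 2` instead of the sphere. After Tonelli, the
    -- substitution `u = ξ • v` turns `|ξ| ^ m dv` into `|ξ|⁻¹ du`; a second Tonelli leaves the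
    -- annulus integral.
    calc ∫⁻ v : V, ∫⁻ ξ : ℝ, A.indicator 1 v * (‖ξ‖ₑ ^ m * G (ξ • v))
        = ∫⁻ ξ : ℝ, ∫⁻ v : V, A.indicator 1 v * (‖ξ‖ₑ ^ m * G (ξ • v)) :=
          lintegral_lintegral_swap hmeas.aemeasurable
      _ = ∫⁻ ξ : ℝ, ∫⁻ u : V,
            ENNReal.ofReal |ξ|⁻¹ * (A.indicator 1 (ξ⁻¹ • u) * G u) := by
          have h0 : ∀ᵐ ξ : ℝ, ξ ≠ 0 := by simp [ae_iff]
          refine lintegral_congr_ae ?_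
          filter_upwards [h0] with ξ hξ
          obtain ⟨K, hK⟩ : ∃ K : V → ENNReal, K = fun u ↦ A.indicator 1 (ξ⁻¹ • u) * G u :=
            ⟨_, rfl⟩
          have hKm : Measurable K := by
            rw [hK]
            exact (hAi.comp (measurable_const_smul _)).mul hG
          have e : ∀ v : V, A.indicator 1 v * (‖ξ‖ₑ ^ m * G (ξ • v)) =
              ‖ξ‖ₑ ^ m * K (ξ • v) := by
            intro v
            simp only [hK, inv_smul_smul₀ hξ]
            ring
          have e2 : ∀ u : V, A.indicator 1 (ξ⁻¹ • u) * G u = K u := fun u ↦ by rw [hK]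
          simp_rw [e, e2]
          rw [lintegral_const_mul' _ _ (by simp), lintegral_comp_smul hKm hξ,
            lintegral_const_mul' _ _ (by simp), ← mul_assoc, hm]
          congr 1
          rw [← _root_.ofReal_norm, Real.norm_eq_abs, ← ENNReal.ofReal_pow (abs_nonneg _),
            ← ENNReal.ofReal_mul (by positivity), abs_inv, abs_pow]
          congr 1
          have : |ξ| ≠ 0 := abs_ne_zero.mpr hξ
          field_simp
          exact (pow_succ _ _).symm
      _ = ∫⁻ u : V, ∫⁻ ξ : ℝ,
            ENNReal.ofReal |ξ|⁻¹ * (A.indicator 1 (ξ⁻¹ • u) * G u) :=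
          lintegral_lintegral_swap hmeas2.aemeasurable
      _ ≤ ∫⁻ u : V, 4 * G u := by
          refine lintegral_mono fun u ↦ ?_
          have e : ∀ ξ : ℝ, ENNReal.ofReal |ξ|⁻¹ * (A.indicator 1 (ξ⁻¹ • u) * G u) ≤
              (ENNReal.ofReal |ξ|⁻¹ *
                {ξ : ℝ | |ξ| < ‖u‖ ∧ ‖u‖ < 2 * |ξ|}.indicator 1 ξ) * G u := by
            intro ξ
            rw [← mul_assoc]
            gcongr
            by_cases hξ : ξ⁻¹ • u ∈ A
            · have h1 := hξ.1
              have h2 := hξ.2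
              rw [norm_smul, norm_inv, Real.norm_eq_abs] at h1 h2
              have h0 : 0 < |ξ| := by
                by_contra h
                have : |ξ| = 0 := le_antisymm (not_lt.mp h) (abs_nonneg _)
                rw [this] at h1
                norm_num at h1
              have hmem : ξ ∈ {ξ : ℝ | |ξ| < ‖u‖ ∧ ‖u‖ < 2 * |ξ|} := by
                constructor
                · rwa [inv_mul_eq_div, one_lt_div h0] at h1
                · rwa [inv_mul_eq_div, div_lt_iff₀ h0] at h2
              rw [Set.indicator_of_mem hξ, Set.indicator_of_mem hmem]
              simp
            · rw [Set.indicator_of_notMem hξ]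
              exact zero_le
          refine (lintegral_mono e).trans ?_
          have hms : MeasurableSet {ξ : ℝ | |ξ| < ‖u‖ ∧ ‖u‖ < 2 * |ξ|} :=
            (measurableSet_lt (f := fun ξ : ℝ ↦ |ξ|) (by fun_prop) (by fun_prop)).inter
              (measurableSet_lt (g := fun ξ : ℝ ↦ 2 * |ξ|) (by fun_prop) (by fun_prop))
          have hm3 : Measurable fun ξ : ℝ ↦ ENNReal.ofReal |ξ|⁻¹ *
              {ξ : ℝ | |ξ| < ‖u‖ ∧ ‖u‖ < 2 * |ξ|}.indicator 1 ξ :=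
            (by fun_prop : Measurable fun ξ : ℝ ↦ ENNReal.ofReal |ξ|⁻¹).mul
              (measurable_one.indicator hms)
          rw [lintegral_mul_const _ hm3]
          gcongr
          exact lintegral_inv_annulus_le _
      _ = 4 * ∫⁻ x, G x := lintegral_const_mul _ hG
  have hne : ∫⁻ v : V, ∫⁻ ξ : ℝ, A.indicator 1 v * (‖ξ‖ₑ ^ m * G (ξ • v)) ≠ ⊤ :=
    ne_top_of_le_ne_top (ENNReal.mul_ne_top (by simp) hfin) htot
  filter_upwards [ae_lt_top hmeas.lintegral_prod_right' hne] with v hv hvA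
  have hvA' : v ∈ A := hvA
  simpa [hvA'] using hv.ne

/-- The one-dimensional marginal of the set `E` in the direction `v`. -/
noncomputable def marginal (E : Set V) (v : V) : Measure ℝ :=
  (volume.restrict E).map fun x ↦ ⟪v, x⟫

theorem isFiniteMeasure_marginal {E : Set V} (hfin : volume E ≠ ⊤) (v : V) :
    IsFiniteMeasure (marginal E v) := by
  have : IsFiniteMeasure (volume.restrict E) := ⟨by simpa using hfin.lt_top⟩
  unfold marginal
  infer_instance

theorem charFun_marginal (E : Set V) (v : V) (ξ : ℝ) :
    charFun (marginal E v) ξ = charFun (volume.restrict E) (ξ • v) := by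
  rw [charFun_apply_real, charFun_apply, marginal,
    integral_map (by fun_prop) (by fun_prop)]
  congr with x
  rw [inner_smul_right, real_inner_comm]
  push_cast
  rfl

theorem marginal_absolutelyContinuous (E : Set V) {v : V} (hv : v ≠ 0) :
    marginal E v ≪ volume := by
  have hs : Function.Surjective (innerₗ V v) := by
    refine LinearMap.surjective fun h ↦ hv ?_
    have := congrArg (fun L : V →ₗ[ℝ] ℝ ↦ L v) h
    simpa using this
  obtain ⟨c, -, hc⟩ := (innerₗ V v).exists_map_addHaar_eq_smul_addHaar volume volume hs
  have h1 : marginal E v ≪ (volume : Measure V).map (innerₗ V v) :=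
    Measure.AbsolutelyContinuous.map Measure.restrict_le_self.absolutelyContinuous
      (by fun_prop : Measurable fun x ↦ ⟪v, x⟫)
  rw [hc] at h1
  exact h1.trans Measure.smul_absolutelyContinuous

/-- For `|ξ| ≥ 1` the weight `|ξ|³` is dominated by `|ξ| ^ m`; near `0` the characteristic function
is bounded. With `m = d - 1`, this is where dimension at least four enters. -/
theorem sobolevEnergy_marginal_ne_top {E : Set V} (hfin : volume E ≠ ⊤) {v : V} {m : ℕ}
    (hm : 3 ≤ m)
    (hv : ∫⁻ ξ : ℝ, ‖ξ‖ₑ ^ m * ‖charFun (volume.restrict E) (ξ • v)‖ₑ ^ 2 ≠ ⊤) :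
    sobolevEnergy (marginal E v) ≠ ⊤ := by
  have : IsFiniteMeasure (volume.restrict E) := ⟨by simpa using hfin.lt_top⟩
  set C := ENNReal.ofReal ((volume.restrict E).real Set.univ) with hC
  have hbound : ∀ ξ : ℝ, ‖ξ‖ₑ ^ 3 * ‖charFun (marginal E v) ξ‖ₑ ^ 2 ≤
      (Set.Icc (-1) 1).indicator (fun _ ↦ C ^ 2) ξ +
        ‖ξ‖ₑ ^ m * ‖charFun (volume.restrict E) (ξ • v)‖ₑ ^ 2 := by
    intro ξ
    rw [charFun_marginal]
    by_cases hξ : ξ ∈ Set.Icc (-1 : ℝ) 1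
    · rw [Set.indicator_of_mem hξ]
      refine le_add_right ?_
      have h1 : ‖ξ‖ₑ ≤ 1 := by
        rw [← _root_.ofReal_norm, ENNReal.ofReal_le_one]
        exact abs_le.mpr hξ
      calc _ ≤ 1 ^ 3 * C ^ 2 := by
            gcongr
            rw [← _root_.ofReal_norm]
            exact ENNReal.ofReal_le_ofReal (norm_charFun_le _)
        _ = C ^ 2 := by simp
    · rw [Set.indicator_of_notMem hξ, zero_add]
      have h1 : 1 ≤ ‖ξ‖ₑ := by
        rw [← _root_.ofReal_norm, ENNReal.one_le_ofReal]
        by_contra h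
        exact hξ (abs_le.mp (not_le.mp h).le)
      gcongr
  refine ne_top_of_le_ne_top ?_ (lintegral_mono hbound)
  rw [lintegral_add_left (measurable_const.indicator measurableSet_Icc),
    lintegral_indicator_const measurableSet_Icc]
  refine ENNReal.add_ne_top.mpr ⟨ENNReal.mul_ne_top (by simp [hC]) (by simp), hv⟩

/-- Almost every vector of the shell is a good direction. A proper subspace is null, so it cannot
contain all good directions without making the nonempty open shell null. -/
theorem span_sobolevEnergy_marginal_ne_top {E : Set V} (hE : MeasurableSet E)
    (hfin : volume E ≠ ⊤) (hdim : 4 ≤ finrank ℝ V) :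
    Submodule.span ℝ {v : V | v ≠ 0 ∧ sobolevEnergy (marginal E v) ≠ ⊤} = ⊤ := by
  obtain ⟨m, hm⟩ : ∃ m, finrank ℝ V = m + 1 := ⟨finrank ℝ V - 1, by omega⟩
  have : IsFiniteMeasure (volume.restrict E) := ⟨by simpa using hfin.lt_top⟩
  have : Nontrivial V := nontrivial_of_finrank_pos (R := ℝ) (by omega)
  have hae := ae_lintegral_radial_ne_top
    (G := fun x ↦ ‖charFun (volume.restrict E) x‖ₑ ^ 2)
    ((measurable_charFun.enorm).pow_const 2)
    (lintegral_charFun_restrict_sq_ne_top hE hfin) hm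
  by_contra hspan
  have hnull := Measure.addHaar_submodule (volume : Measure V) _ hspan
  have hcontra : ∀ᵐ v : V, ¬ (1 < ‖v‖ ∧ ‖v‖ < 2) := by
    filter_upwards [hae, compl_mem_ae_iff.mpr hnull] with v hv1 hv2 hvA
    refine hv2 (Submodule.subset_span ⟨?_, ?_⟩)
    · rintro rfl
      rw [norm_zero] at hvA
      linarith [hvA.1]
    · exact sobolevEnergy_marginal_ne_top hfin (by omega) (hv1 hvA)
  have hopen : IsOpen {v : V | 1 < ‖v‖ ∧ ‖v‖ < 2} :=
    (isOpen_lt continuous_const continuous_norm).inter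
      (isOpen_lt continuous_norm continuous_const)
  obtain ⟨x, hx⟩ := exists_norm_eq V (c := 3 / 2) (by norm_num)
  have hpos := hopen.measure_pos volume ⟨x, by rw [Set.mem_ofPred_eq, hx]; norm_num⟩
  rw [ae_iff] at hcontra
  simp only [not_not] at hcontra
  exact hpos.ne' hcontra

end GoodDirections

/-! ### Slabs as test sets and the recovery of `r` and `x`. -/

section MagnifiedCopies

open Module
open scoped RealInnerProductSpace Pointwise

variable {d : ℕ}

theorem volume_magnifiedCopy_inter (E T : Set (EuclideanSpace ℝ (Fin d))) {r : ℝ} (hr : 0 < r)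
    (x : EuclideanSpace ℝ (Fin d)) :
    volume (magnifiedCopy E r x ∩ T) =
      ENNReal.ofReal (r ^ d) * volume (E ∩ (fun y ↦ r • y + x) ⁻¹' T) := by
  have e : magnifiedCopy E r x ∩ T =
      (fun y ↦ y + x) '' (r • (E ∩ (fun y ↦ r • y + x) ⁻¹' T)) := by
    rw [magnifiedCopy, ← Set.image_inter_preimage, ← Set.image_smul, Set.image_image]
  rw [e, Set.image_add_right, measure_preimage_add_right, Measure.addHaar_smul,
    finrank_euclideanSpace_fin, abs_of_pos (by positivity)]

theorem volume_magnifiedCopy (E : Set (EuclideanSpace ℝ (Fin d))) {r : ℝ} (hr : 0 < r)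
    (x : EuclideanSpace ℝ (Fin d)) :
    volume (magnifiedCopy E r x) = ENNReal.ofReal (r ^ d) * volume E := by
  simpa using volume_magnifiedCopy_inter E Set.univ hr x

theorem nullMeasurableSet_magnifiedCopy {E : Set (EuclideanSpace ℝ (Fin d))}
    (hE : NullMeasurableSet E volume) {r : ℝ} (hr : 0 < r) (x : EuclideanSpace ℝ (Fin d)) :
    NullMeasurableSet (magnifiedCopy E r x) volume := by
  have e : magnifiedCopy E r x = (fun y ↦ r⁻¹ • (y - x)) ⁻¹' E := by
    ext y
    constructor
    · rintro ⟨z, hz, rfl⟩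
      simpa [inv_smul_smul₀ hr.ne'] using hz
    · intro hy
      exact ⟨_, hy, by simp [smul_inv_smul₀ hr.ne']⟩
  rw [e]
  have h1 : Measure.QuasiMeasurePreserving (fun y : EuclideanSpace ℝ (Fin d) ↦ r⁻¹ • y)
      volume volume := Measure.quasiMeasurePreserving_smul volume (inv_ne_zero hr.ne')
  exact hE.preimage (h1.comp (measurePreserving_sub_right volume x).quasiMeasurePreserving)

theorem volume_magnifiedCopy_inter_slab {E E' : Set (EuclideanSpace ℝ (Fin d))}
    (hE' : E' =ᵐ[volume] E) {S : Set ℝ} (hS : MeasurableSet S) {r : ℝ} (hr : 0 < r)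
    (x v : EuclideanSpace ℝ (Fin d)) :
    volume (magnifiedCopy E r x ∩ {y | ⟪v, y⟫ ∈ S}) =
      ENNReal.ofReal (r ^ d) * marginal E' v ((fun s ↦ r * s + ⟪v, x⟫) ⁻¹' S) := by
  have hm1 : MeasurableSet ((fun s ↦ r * s + ⟪v, x⟫) ⁻¹' S) :=
    hS.preimage (by fun_prop)
  rw [volume_magnifiedCopy_inter E _ hr x, marginal,
    Measure.map_apply (by fun_prop) hm1,
    Measure.restrict_apply (hm1.preimage (by fun_prop)), Set.inter_comm _ E']
  congr 1
  have e : (fun y ↦ r • y + x) ⁻¹' {y | ⟪v, y⟫ ∈ S} =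
      (fun y ↦ ⟪v, y⟫) ⁻¹' ((fun s ↦ r * s + ⟪v, x⟫) ⁻¹' S) := by
    ext y
    simp [inner_add_right, inner_smul_right]
  rw [e]
  exact measure_congr (hE'.symm.inter Filter.EventuallyEq.rfl)

theorem exists_testSets_magnifiedCopy (hd : 4 ≤ d) {E : Set (EuclideanSpace ℝ (Fin d))}
    (hmeas : NullMeasurableSet E volume) (hbdd : Bornology.IsBounded E) (hpos : 0 < volume E) :
    ∃ T : Fin (d + 1) → Set (EuclideanSpace ℝ (Fin d)), (∀ i, MeasurableSet (T i)) ∧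
      ∀ (x x' : EuclideanSpace ℝ (Fin d)) (r r' : ℝ), 1 ≤ r → 1 ≤ r' →
        (∀ i, volume (magnifiedCopy E r x ∩ T i) = volume (magnifiedCopy E r' x' ∩ T i)) →
        x = x' ∧ r = r' := by
  -- The Fourier estimates need a Borel set; passing to a Borel subset of full measure changes no
  -- volume.
  obtain ⟨E', hsub, hE'm, hE'⟩ := hmeas.exists_measurable_subset_ae_eq
  have hfinE : volume E ≠ ⊤ := hbdd.measure_lt_top.ne
  have hfin : volume E' ≠ ⊤ := (hbdd.subset hsub).measure_lt_top.ne
  have hpos' : volume E' ≠ 0 := by rw [measure_congr hE']; exact hpos.ne'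
  obtain ⟨R, hR, hER⟩ := (hbdd.subset hsub).exists_pos_norm_le
  have hspan := span_sobolevEnergy_marginal_ne_top hE'm hfin (by simpa using hd)
  obtain ⟨v, hv, hvspan, -⟩ := Submodule.exists_fun_fin_finrank_span_eq ℝ
    {v : EuclideanSpace ℝ (Fin d) | v ≠ 0 ∧ sobolevEnergy (marginal E' v) ≠ ⊤}
  replace hvspan := hvspan.trans hspan
  have hrank : finrank ℝ (Submodule.span ℝ
      {v : EuclideanSpace ℝ (Fin d) | v ≠ 0 ∧ sobolevEnergy (marginal E' v) ≠ ⊤}) = d := by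
    rw [hspan, finrank_top, finrank_euclideanSpace_fin]
  have hset : ∀ i, ∃ S, MeasurableSet S ∧ ∀ r : ℝ, 1 ≤ r →
      StrictMono fun t ↦ (marginal E' (v i)).real ((fun s ↦ r * s + t) ⁻¹' S) := by
    intro i
    have := isFiniteMeasure_marginal hfin (v i)
    refine exists_measurableSet_strictMono_measure
      (marginal_absolutelyContinuous E' (hv i).1) (hv i).2 ?_ (R := ‖v i‖ * R)
      (by positivity) ?_
    · intro h0
      rw [marginal, Measure.map_eq_zero_iff (by fun_prop), Measure.restrict_eq_zero] at h0
      exact hpos' h0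
    · rw [marginal, ae_map_iff (by fun_prop)
        (measurableSet_le (by fun_prop) measurable_const)]
      filter_upwards [ae_restrict_mem hE'm] with y hy
      exact (abs_real_inner_le_norm _ _).trans (by gcongr; exact hER y hy)
  choose S hSm hS using hset
  -- Index `0` is the whole space, for `r`; the remaining `d` indices are the slabs, transported
  -- along `hrank` from the index type of the spanning family.
  refine ⟨Fin.cons Set.univ fun i ↦ {y | ⟪v (Fin.cast hrank.symm i), y⟫ ∈
    S (Fin.cast hrank.symm i)}, ?_, ?_⟩
  · refine Fin.cases MeasurableSet.univ fun i ↦ ?_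
    exact (hSm _).preimage (by fun_prop)
  · intro x x' r r' hr hr' heq
    have hr0 : 0 < r := by linarith
    have hr0' : 0 < r' := by linarith
    have hrr : r = r' := by
      have h := heq 0
      simp only [Fin.cons_zero, Set.inter_univ] at h
      rw [volume_magnifiedCopy E hr0, volume_magnifiedCopy E hr0',
        ENNReal.mul_left_inj hpos.ne' hfinE,
        ENNReal.ofReal_eq_ofReal_iff (by positivity) (by positivity)] at h
      exact (pow_left_inj₀ hr0.le hr0'.le (by omega)).mp h
    subst hrr
    refine ⟨?_, rfl⟩
    have hinner : ∀ i, ⟪v i, x⟫ = ⟪v i, x'⟫ := by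
      intro i
      have h := heq (Fin.succ (Fin.cast hrank i))
      simp only [Fin.cons_succ, Fin.cast_cast, Fin.cast_eq_self] at h
      rw [volume_magnifiedCopy_inter_slab hE' (hSm i) hr0,
        volume_magnifiedCopy_inter_slab hE' (hSm i) hr0,
        ENNReal.mul_right_inj (by simp only [ne_eq, ENNReal.ofReal_eq_zero, not_le]; positivity)
          ENNReal.ofReal_ne_top] at h
      exact (hS i r hr).injective (congrArg ENNReal.toReal h)
    have hall : ∀ w : EuclideanSpace ℝ (Fin d), ⟪w, x⟫ = ⟪w, x'⟫ := by
      intro w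
      have hw : w ∈ Submodule.span ℝ (Set.range v) := by rw [hvspan]; trivial
      induction hw using Submodule.span_induction with
      | mem w hw => obtain ⟨i, rfl⟩ := hw; exact hinner i
      | zero => simp
      | add a b _ _ ha hb => rw [inner_add_left, inner_add_left, ha, hb]
      | smul c a _ ha => rw [inner_smul_left, inner_smul_left, ha]
    exact ext_inner_left ℝ hall

end MagnifiedCopies

theorem corollaryc (d : ℕ) (hd : 4 ≤ d) (E : Set (EuclideanSpace ℝ (Fin d)))
    (hmeas : NullMeasurableSet E volume) (hbdd : Bornology.IsBounded E) (hpos : 0 < volume E) :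
    CanBeReconstructed
      {S | ∃ (r : ℝ) (x : EuclideanSpace ℝ (Fin d)), 1 ≤ r ∧ S = magnifiedCopy E r x} (d + 1) ∧
    ∃ T : Fin (d + 1) → Set (EuclideanSpace ℝ (Fin d)), (∀ i, MeasurableSet (T i)) ∧
      ∀ (x x' : EuclideanSpace ℝ (Fin d)) (r r' : ℝ), 1 ≤ r → 1 ≤ r' → (x, r) ≠ (x', r') →
        ∃ i, volume (magnifiedCopy E r x ∩ T i) ≠ volume (magnifiedCopy E r' x' ∩ T i) := by
  obtain ⟨T, hTm, hT⟩ := exists_testSets_magnifiedCopy hd hmeas hbdd hpos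
  refine ⟨⟨?_, T, hTm, ?_⟩, T, hTm, ?_⟩
  · rintro _ ⟨r, x, hr, rfl⟩
    have hr0 : 0 < r := by linarith
    refine ⟨nullMeasurableSet_magnifiedCopy hmeas hr0 x, ?_⟩
    rw [volume_magnifiedCopy E hr0]
    exact ENNReal.mul_lt_top ENNReal.ofReal_lt_top hbdd.measure_lt_top
  · rintro _ ⟨r, x, hr, rfl⟩ _ ⟨r', x', hr', rfl⟩ h
    obtain ⟨rfl, rfl⟩ := hT x x' r r' hr hr' h
    rfl
  · intro x x' r r' hr hr' hne
    by_contra! h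
    obtain ⟨rfl, rfl⟩ := hT x x' r r' hr hr' h
    exact hne rfl
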